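/- Let $M$ be a finitely generated abelian group, let $L \subseteq M$ be a finite subgroup of order $n$, and let $S=\bigoplus_{m\in M}S_m$ be an $M$-graded (left) Noetherian ring, not necessarily commutative, in which $n$ is invertible. Let $T$ be the ring $S$ with the $M/L$-grading $T_{[m]} := \bigoplus_{l\in L} S_{m+l}$. For a graded Noetherian ring $R$, let $\operatorname{gr\,mod}R$ be the abelian category of finitely generated graded (left) $R$-modules and degree-zero $R$-linear maps, and let the graded singularity category $D^{gr}_{sg}(R)$ be the Verdier quotient of $D^b(\operatorname{gr\,mod}R)$ by the full subcategory of perfect complexes, i.e. the objects isomorphic to bounded complexes of finitely generated graded projective modules. For $l\in L$ the twist $E\mapsto E(l)$, $E(l)_m := E_{m+l}$, induces a triangulated autoequivalence of $D^{gr}_{sg}(S)$; this gives an action of $L$ on $D^{gr}_{sg}(S)$. The orbit category $D^{gr}_{sg}(S)/L$ has the same objects as $D^{gr}_{sg}(S)$ and morphisms $$\operatorname{Hom}_{D^{gr}_{sg}(S)/L}(A,B)=\bigoplus_{l\in L}\operatorname{Hom}_{D^{gr}_{sg}(S)}(A,B(l)),$$ with the composition of $f\colon A\to B(a)$ and $g\colon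 B\to C(b)$ given by $g(a)\circ f\colon A\to C(a+b)$. Then $D^{gr}_{sg}(S)$ is an $L$-cover of $D^{gr}_{sg}(T)$: there is a fully faithful additive functor $$F\colon D^{gr}_{sg}(S)/L\longrightarrow D^{gr}_{sg}(T)$$ such that every object of $D^{gr}_{sg}(T)$ is a direct summand of an object in the essential image of $F$. -/

import Mathlib

open CategoryTheory Limits

universe u v

/-- A family of subgroups is an internal grading as soon as there are component maps for it. -/
theorem DirectSum.isInternal_of_projections {ι : Type*} [DecidableEq ι] {N : Type*} [AddCommGroup N]
    (𝒩 : ι → AddSubgroup N) (p : ι → N →+ N) (h₁ : ∀ i x, p i x ∈ 𝒩 i)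
    (h₂ : ∀ i, ∀ x ∈ 𝒩 i, p i x = x) (h₃ : ∀ i j, i ≠ j → ∀ x ∈ 𝒩 i, p j x = 0)
    (h₄ : ∀ x, ∃ s : Finset ι, ∑ i ∈ s, p i x = x) : DirectSum.IsInternal 𝒩 := by
  constructor
  · rw [injective_iff_map_eq_zero]
    intro v hv
    ext i
    have key : p i (DirectSum.coeAddMonoidHom 𝒩 v) = v i := by
      clear hv
      induction v using DirectSum.induction_on with
      | zero => simp
      | of j x =>
        by_cases h : j = i
        · subst h; simp [h₂ _ _ x.2]
        · simp [h₃ _ _ h _ x.2, DirectSum.of_eq_of_ne _ _ _ (Ne.symm h)]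
      | add x y hx hy => simp [hx, hy]
    rw [hv, map_zero] at key
    simpa using key.symm
  · intro x
    obtain ⟨s, hs⟩ := h₄ x
    refine ⟨∑ i ∈ s, DirectSum.of (fun i => 𝒩 i) i ⟨p i x, h₁ i x⟩, ?_⟩
    simpa [map_sum] using hs

/-- The component maps of an internal grading. -/
theorem DirectSum.IsInternal.exists_projections {ι : Type*} [DecidableEq ι] {N : Type*} [AddCommGroup N]
    {𝒩 : ι → AddSubgroup N} (h : DirectSum.IsInternal 𝒩) :
    ∃ p : ι → N →+ N, (∀ i x, p i x ∈ 𝒩 i) ∧ (∀ i, ∀ x ∈ 𝒩 i, p i x = x) ∧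
      (∀ i j, i ≠ j → ∀ x ∈ 𝒩 i, p j x = 0) ∧ ∀ x, ∃ s : Finset ι, ∑ i ∈ s, p i x = x := by
  classical
  let := h.chooseDecomposition
  refine ⟨fun i => (𝒩 i).subtype.comp ((DFinsupp.evalAddMonoidHom i).comp
    (DirectSum.decomposeAddEquiv 𝒩).toAddMonoidHom), fun i x => ?_, fun i x hx => ?_,
    fun i j hij x hx => ?_, fun x => ?_⟩
  · exact (DirectSum.decompose 𝒩 x i).2
  · exact DirectSum.decompose_of_mem_same 𝒩 hx
  · exact DirectSum.decompose_of_mem_ne 𝒩 hx hij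
  · exact ⟨_, DirectSum.sum_support_decompose 𝒩 x⟩

section
variable {S : Type u} [Ring S] {M : Type v} [AddCommGroup M]

open Classical in
/-- A finitely generated `M`-graded left module over the ring `S` graded by the subgroups
`𝒜 m` (`m : M`): a finitely generated `S`-module with a decomposition `E = ⨁ m, E_m` such that
`S_a E_b ⊆ E_(a+b)`. -/
structure FGGrMod (𝒜 : M → AddSubgroup S) where
  carrier : Type u
  [addCommGroup : AddCommGroup carrier]
  [module : Module S carrier]
  grading : M → AddSubgroup carrier
  isInternal : DirectSum.IsInternal grading
  smul_mem : ∀ {a b : M} {s : S} {x : carrier}, s ∈ 𝒜 a → x ∈ grading b → s • x ∈ grading (a + b)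
  [finite : Module.Finite S carrier]

namespace FGGrMod

attribute [instance] FGGrMod.addCommGroup FGGrMod.module FGGrMod.finite

variable {𝒜 : M → AddSubgroup S}

/-- Morphisms are the `S`-linear maps of degree zero. -/
@[ext]
structure Hom (E F : FGGrMod 𝒜) where
  toLin : E.carrier →ₗ[S] F.carrier
  map_mem : ∀ {m : M} {x : E.carrier}, x ∈ E.grading m → toLin x ∈ F.grading m

instance : Category (FGGrMod 𝒜) where
  Hom := Hom
  id E := ⟨LinearMap.id, fun h => h⟩
  comp f g := ⟨g.toLin.comp f.toLin, fun h => g.map_mem (f.map_mem h)⟩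

@[ext]
theorem hom_ext {E F : FGGrMod 𝒜} {f g : E ⟶ F} (h : ∀ x, f.toLin x = g.toLin x) : f = g :=
  Hom.ext (LinearMap.ext h)

@[simp] theorem id_toLin (E : FGGrMod 𝒜) : Hom.toLin (𝟙 E) = LinearMap.id := rfl
@[simp] theorem comp_toLin {E F G : FGGrMod 𝒜} (f : E ⟶ F) (g : F ⟶ G) :
    (f ≫ g).toLin = g.toLin.comp f.toLin := rfl

section Preadditive
variable {E F : FGGrMod 𝒜}
instance : Zero (E ⟶ F) := ⟨⟨0, fun _ => zero_mem _⟩⟩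
instance : Add (E ⟶ F) :=
  ⟨fun f g => ⟨f.toLin + g.toLin, fun h => add_mem (f.map_mem h) (g.map_mem h)⟩⟩
instance : Neg (E ⟶ F) := ⟨fun f => ⟨-f.toLin, fun h => neg_mem (f.map_mem h)⟩⟩
instance : Sub (E ⟶ F) :=
  ⟨fun f g => ⟨f.toLin - g.toLin, fun h => sub_mem (f.map_mem h) (g.map_mem h)⟩⟩
instance : SMul ℕ (E ⟶ F) := ⟨fun n f => ⟨n • f.toLin, fun h => nsmul_mem (f.map_mem h) n⟩⟩
instance : SMul ℤ (E ⟶ F) := ⟨fun n f => ⟨n • f.toLin, fun h => zsmul_mem (f.map_mem h) n⟩⟩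
instance : AddCommGroup (E ⟶ F) :=
  Function.Injective.addCommGroup Hom.toLin (fun _ _ h => Hom.ext h) rfl (fun _ _ => rfl)
    (fun _ => rfl) (fun _ _ => rfl) (fun _ _ => rfl) (fun _ _ => rfl)
@[simp] theorem zero_toLin : Hom.toLin (0 : E ⟶ F) = 0 := rfl
@[simp] theorem add_toLin (f g : E ⟶ F) : (f + g).toLin = f.toLin + g.toLin := rfl
end Preadditive

instance : Preadditive (FGGrMod 𝒜) where
  add_comp _ _ _ f g h := by ext x; simp
  comp_add _ _ _ f g h := by ext x; simp

theorem exists_projections (E : FGGrMod 𝒜) : ∃ p : M → E.carrier →+ E.carrier,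
    (∀ i x, p i x ∈ E.grading i) ∧ (∀ i, ∀ x ∈ E.grading i, p i x = x) ∧
      (∀ i j, i ≠ j → ∀ x ∈ E.grading i, p j x = 0) ∧
      ∀ x, ∃ s : Finset M, ∑ i ∈ s, p i x = x := by
  classical
  exact E.isInternal.exists_projections

/-- The `i`-th homogeneous component of an element. -/
noncomputable def proj (E : FGGrMod 𝒜) : M → E.carrier →+ E.carrier := E.exists_projections.choose
theorem proj_mem (E : FGGrMod 𝒜) (i : M) (x : E.carrier) : E.proj i x ∈ E.grading i :=
  E.exists_projections.choose_spec.1 i x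
theorem proj_same (E : FGGrMod 𝒜) {i : M} {x : E.carrier} (h : x ∈ E.grading i) : E.proj i x = x :=
  E.exists_projections.choose_spec.2.1 i x h
theorem proj_ne (E : FGGrMod 𝒜) {i j : M} (hij : i ≠ j) {x : E.carrier} (h : x ∈ E.grading i) :
    E.proj j x = 0 :=
  E.exists_projections.choose_spec.2.2.1 i j hij x h
theorem exists_sum_proj (E : FGGrMod 𝒜) (x : E.carrier) : ∃ s : Finset M, ∑ i ∈ s, E.proj i x = x :=
  E.exists_projections.choose_spec.2.2.2 x

theorem mem_iff_proj (E : FGGrMod 𝒜) {i : M} {x : E.carrier} : x ∈ E.grading i ↔ E.proj i x = x :=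
  ⟨E.proj_same, fun h => h ▸ E.proj_mem i x⟩

theorem Hom.map_proj {E F : FGGrMod 𝒜} (f : E ⟶ F) (i : M) (x : E.carrier) :
    f.toLin (E.proj i x) = F.proj i (f.toLin x) := by
  classical
  obtain ⟨s, hs⟩ := E.exists_sum_proj x
  have key : ∀ k, f.toLin (E.proj i (E.proj k x)) = F.proj i (f.toLin (E.proj k x)) := by
    intro k
    by_cases h : k = i
    · subst h
      rw [E.proj_same (E.proj_mem k x), F.proj_same (f.map_mem (E.proj_mem k x))]
    · rw [E.proj_ne h (E.proj_mem k x), F.proj_ne h (f.map_mem (E.proj_mem k x)), map_zero]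
  rw [← hs]
  simp only [map_sum, key]

theorem exists_sum_proj' (E : FGGrMod 𝒜) (x : E.carrier) :
    ∃ s : Finset M, ∀ t, s ⊆ t → ∑ i ∈ t, E.proj i x = x := by
  classical
  obtain ⟨s, hs⟩ := E.exists_sum_proj x
  refine ⟨s, fun t hst => ?_⟩
  rw [← Finset.sum_subset hst, hs]
  intro i _ hi
  rw [← hs, map_sum]
  refine Finset.sum_eq_zero fun k hk => E.proj_ne ?_ (E.proj_mem k x)
  rintro rfl
  exact hi hk

theorem mem_of_injective {E F : FGGrMod 𝒜} (f : E ⟶ F) (hf : Function.Injective f.toLin) {i : M}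
    {x : E.carrier} (h : f.toLin x ∈ F.grading i) : x ∈ E.grading i := by
  rw [mem_iff_proj]
  apply hf
  rw [f.map_proj, F.proj_same h]

section kernels
variable {E F : FGGrMod 𝒜} (f : E ⟶ F)

open Classical in
theorem isInternal_comap : DirectSum.IsInternal fun i : M => (E.grading i).comap
      (LinearMap.ker f.toLin).subtype.toAddMonoidHom :=
  DirectSum.isInternal_of_projections _
    (fun i => ((E.proj i).comp (LinearMap.ker f.toLin).subtype.toAddMonoidHom).codRestrict
      (LinearMap.ker f.toLin) (fun x => by
        have : f.toLin x = 0 := x.2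
        simp [f.map_proj, this]))
    (fun i x => E.proj_mem i x) (fun i x hx => Subtype.ext (E.proj_same hx))
    (fun i j h x hx => Subtype.ext (E.proj_ne h hx)) (fun x => by
      obtain ⟨s, hs⟩ := E.exists_sum_proj (x : E.carrier)
      refine ⟨s, Subtype.ext ?_⟩
      refine (AddSubmonoidClass.coe_finsetSum _ _).trans hs)

variable [IsNoetherianRing S]

/-- The kernel of a morphism, with the induced grading. -/
def ker : FGGrMod 𝒜 where
  carrier := LinearMap.ker f.toLin
  grading i := (E.grading i).comap (LinearMap.ker f.toLin).subtype.toAddMonoidHom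
  isInternal := isInternal_comap f
  smul_mem hs hx := E.smul_mem hs hx

def kerι : ker f ⟶ E := ⟨(LinearMap.ker f.toLin).subtype, fun h => h⟩

theorem kerι_comp : kerι f ≫ f = 0 := by ext x; exact x.2

def kerLift {G : FGGrMod 𝒜} (g : G ⟶ E) (h : g ≫ f = 0) : G ⟶ ker f :=
  ⟨g.toLin.codRestrict _ fun x => congr($(h).toLin x), fun hx => g.map_mem hx⟩

def kerIsLimit : IsLimit (KernelFork.ofι (kerι f) (kerι_comp f)) :=
  KernelFork.IsLimit.ofι _ _ (fun g h => kerLift f g h) (fun _ _ => rfl)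
    (fun g h m hm => by
      ext x
      exact Subtype.ext congr($(hm).toLin x))

instance : HasKernels (FGGrMod 𝒜) := ⟨fun f => ⟨⟨⟨_, kerIsLimit f⟩⟩⟩⟩

theorem injective_of_mono [Mono f] : Function.Injective f.toLin := by
  have h : kerι f = 0 := by rw [← cancel_mono f, kerι_comp, zero_comp]
  rw [← LinearMap.ker_eq_bot, eq_bot_iff]
  intro x hx
  exact congr($(h).toLin ⟨x, hx⟩)
end kernels

section cokernels
variable {E F : FGGrMod 𝒜} (f : E ⟶ F)

theorem exists_projQ (i : M) : ∃ q : (F.carrier ⧸ LinearMap.range f.toLin) →+ (F.carrier ⧸ LinearMap.range f.toLin),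
    ∀ x, q (Submodule.Quotient.mk x) = Submodule.Quotient.mk (F.proj i x) := by
  refine ⟨QuotientAddGroup.map (LinearMap.range f.toLin).toAddSubgroup
    (LinearMap.range f.toLin).toAddSubgroup (F.proj i) ?_, fun x => rfl⟩
  rintro _ ⟨x, rfl⟩
  exact ⟨E.proj i x, f.map_proj i x⟩

open Classical in
theorem isInternal_map : DirectSum.IsInternal fun i : M => (F.grading i).map
      (LinearMap.range f.toLin).mkQ.toAddMonoidHom := by
  choose q hq using exists_projQ f
  refine DirectSum.isInternal_of_projections _ q ?_ ?_ ?_ ?_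
  · intro i x
    obtain ⟨x, rfl⟩ := Submodule.Quotient.mk_surjective _ x
    exact ⟨_, F.proj_mem i x, (hq i x).symm⟩
  · rintro i _ ⟨x, hx, rfl⟩
    exact (hq i x).trans (congrArg _ (F.proj_same hx))
  · rintro i j h _ ⟨x, hx, rfl⟩
    exact (hq j x).trans (congrArg _ (F.proj_ne h hx))
  · intro x
    obtain ⟨x, rfl⟩ := Submodule.Quotient.mk_surjective _ x
    obtain ⟨s, hs⟩ := F.exists_sum_proj x
    refine ⟨s, ?_⟩
    simp only [hq]
    conv_rhs => rw [← hs]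
    exact (map_sum (LinearMap.range f.toLin).mkQ _ _).symm

/-- The cokernel of a morphism, with the induced grading. -/
def coker : FGGrMod 𝒜 where
  carrier := F.carrier ⧸ LinearMap.range f.toLin
  grading i := (F.grading i).map (LinearMap.range f.toLin).mkQ.toAddMonoidHom
  isInternal := isInternal_map f
  smul_mem := by
    rintro a b s _ hs ⟨x, hx, rfl⟩
    exact ⟨s • x, F.smul_mem hs hx, rfl⟩

def cokerπ : F ⟶ coker f := ⟨(LinearMap.range f.toLin).mkQ, fun h => ⟨_, h, rfl⟩⟩

theorem comp_cokerπ : f ≫ cokerπ f = 0 := by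
  ext x
  exact (Submodule.Quotient.mk_eq_zero _).2 ⟨x, rfl⟩

def cokerDesc {G : FGGrMod 𝒜} (g : F ⟶ G) (h : f ≫ g = 0) : coker f ⟶ G :=
  ⟨(LinearMap.range f.toLin).liftQ g.toLin (by
    rintro _ ⟨x, rfl⟩
    exact congr($(h).toLin x)), by
    rintro m _ ⟨x, hx, rfl⟩
    exact g.map_mem hx⟩

def cokerIsColimit : IsColimit (CokernelCofork.ofπ (cokerπ f) (comp_cokerπ f)) :=
  CokernelCofork.IsColimit.ofπ _ _ (fun g h => cokerDesc f g h) (fun _ _ => rfl)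
    (fun g h m hm => by
      ext x
      obtain ⟨x, rfl⟩ := Submodule.Quotient.mk_surjective _ x
      exact congr($(hm).toLin x))

instance : HasCokernels (FGGrMod 𝒜) := ⟨fun f => ⟨⟨⟨_, cokerIsColimit f⟩⟩⟩⟩

theorem surjective_of_epi [Epi f] : Function.Surjective f.toLin := by
  have h : cokerπ f = 0 := by rw [← cancel_epi f, comp_cokerπ, comp_zero]
  intro y
  exact (Submodule.Quotient.mk_eq_zero _).1 congr($(h).toLin y)
end cokernels

section products

open Classical in
def zeroObj : FGGrMod 𝒜 where
  carrier := PUnit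
  grading _ := ⊤
  isInternal := DirectSum.isInternal_of_projections _ (fun _ => 0) (fun _ _ => trivial)
    (fun _ _ _ => rfl) (fun _ _ _ _ _ => rfl) (fun _ => ⟨∅, rfl⟩)
  smul_mem _ _ := trivial

instance : HasZeroObject (FGGrMod 𝒜) := ⟨zeroObj, by
  rw [IsZero.iff_id_eq_zero]
  ext x
  rfl⟩

variable (E F : FGGrMod 𝒜)

open Classical in
def prod : FGGrMod 𝒜 where
  carrier := E.carrier × F.carrier
  grading i := (E.grading i).prod (F.grading i)
  isInternal := DirectSum.isInternal_of_projections _ (fun i => (E.proj i).prodMap (F.proj i))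
    (fun i x => ⟨E.proj_mem i _, F.proj_mem i _⟩)
    (fun i x hx => Prod.ext (E.proj_same hx.1) (F.proj_same hx.2))
    (fun i j h x hx => Prod.ext (E.proj_ne h hx.1) (F.proj_ne h hx.2)) (fun x => by
      obtain ⟨s, hs⟩ := E.exists_sum_proj' x.1
      obtain ⟨t, ht⟩ := F.exists_sum_proj' x.2
      refine ⟨s ∪ t, Prod.ext ?_ ?_⟩
      · exact (Prod.fst_sum).trans (hs _ Finset.subset_union_left)
      · exact (Prod.snd_sum).trans (ht _ Finset.subset_union_right))
  smul_mem hs hx := ⟨E.smul_mem hs hx.1, F.smul_mem hs hx.2⟩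

instance : HasBinaryProducts (FGGrMod 𝒜) := by
  have (E F : FGGrMod 𝒜) : HasLimit (pair E F) :=
    ⟨⟨⟨BinaryFan.mk (P := prod E F) ⟨LinearMap.fst S E.carrier F.carrier, fun h => h.1⟩
        ⟨LinearMap.snd S E.carrier F.carrier, fun h => h.2⟩,
      BinaryFan.isLimitMk
        (fun s => ⟨s.fst.toLin.prod s.snd.toLin, fun h => ⟨s.fst.map_mem h, s.snd.map_mem h⟩⟩)
        (fun _ => rfl) (fun _ => rfl) (fun s m h₁ h₂ => by
          ext x
          exact Prod.ext congr($(h₁).toLin x) congr($(h₂).toLin x))⟩⟩⟩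
  exact hasBinaryProducts_of_hasLimit_pair _

instance : HasFiniteProducts (FGGrMod 𝒜) := hasFiniteProducts_of_has_binary_and_terminal
end products

section abelian
variable {E F : FGGrMod 𝒜} (f : E ⟶ F) [IsNoetherianRing S]

@[reducible] noncomputable def normalMono [Mono f] : NormalMono f where
  Z := coker f
  g := cokerπ f
  w := comp_cokerπ f
  isLimit := by
    have hf := injective_of_mono f
    have key {G : FGGrMod 𝒜} (g : G ⟶ F) (h : g ≫ cokerπ f = 0) (x : G.carrier) :
        g.toLin x ∈ LinearMap.range f.toLin :=
      (Submodule.Quotient.mk_eq_zero _).1 congr($(h).toLin x)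
    let e := LinearEquiv.ofInjective f.toLin hf
    have he (y : LinearMap.range f.toLin) : f.toLin (e.symm y) = y :=
      congrArg Subtype.val (e.apply_symm_apply y)
    exact KernelFork.IsLimit.ofι _ _
      (fun g h => ⟨e.symm.toLinearMap.comp (g.toLin.codRestrict _ (key g h)), fun hx =>
        mem_of_injective f hf (by
          refine (congrArg (· ∈ F.grading _) (he _)).mpr (g.map_mem hx))⟩)
      (fun g h => by ext x; exact he _)
      (fun g h m hm => by
        ext x
        exact hf ((congr($(hm).toLin x)).trans (he ⟨g.toLin x, key g h x⟩).symm))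

@[reducible] noncomputable def normalEpi [Epi f] : NormalEpi f where
  W := ker f
  g := kerι f
  w := kerι_comp f
  isColimit := by
    have hf := surjective_of_epi f
    let e := f.toLin.quotKerEquivOfSurjective hf
    have he (x : E.carrier) : e.symm (f.toLin x) = Submodule.Quotient.mk x :=
      (LinearEquiv.symm_apply_eq _).2 rfl
    have key {G : FGGrMod 𝒜} (g : E ⟶ G) (h : kerι f ≫ g = 0) :
        LinearMap.ker f.toLin ≤ LinearMap.ker g.toLin := fun x hx => congr($(h).toLin ⟨x, hx⟩)
    have fac {G : FGGrMod 𝒜} (g : E ⟶ G) (h : kerι f ≫ g = 0) (x : E.carrier) :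
        ((LinearMap.ker f.toLin).liftQ g.toLin (key g h)) (e.symm (f.toLin x)) = g.toLin x := by
      rw [he]; rfl
    exact CokernelCofork.IsColimit.ofπ _ _
      (fun {G} g h => ⟨((LinearMap.ker f.toLin).liftQ g.toLin (key g h)).comp e.symm.toLinearMap, by
        intro m y hy
        obtain ⟨x, rfl⟩ := hf y
        rw [← F.proj_same hy, ← f.map_proj]
        exact (congrArg (· ∈ G.grading _) (fac g h _)).mpr (g.map_mem (E.proj_mem m x))⟩)
      (fun g h => by ext x; exact fac g h x)
      (fun g h m hm => by
        ext y
        obtain ⟨x, rfl⟩ := hf y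
        exact (congr($(hm).toLin x)).trans (fac g h x).symm)

/-- Finitely generated graded modules over a Noetherian graded ring form an abelian category. -/
noncomputable instance : Abelian (FGGrMod 𝒜) where
  normalMonoOfMono f _ := ⟨normalMono f⟩
  normalEpiOfEpi f _ := ⟨normalEpi f⟩
end abelian

section twist

open Classical in
/-- The twist `E(a)` of a graded module: `E(a)_m = E_(m+a)`. -/
def twistObj (a : M) (E : FGGrMod 𝒜) : FGGrMod 𝒜 where
  carrier := E.carrier
  grading m := E.grading (m + a)
  isInternal := DirectSum.isInternal_of_projections _ (fun m => E.proj (m + a))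
    (fun m x => E.proj_mem _ x) (fun m x hx => E.proj_same hx)
    (fun i j h x hx => E.proj_ne (by simpa using h) hx) (fun x => by
      obtain ⟨s, hs⟩ := E.exists_sum_proj x
      refine ⟨s.map (Equiv.addRight (-a)).toEmbedding, ?_⟩
      simpa using hs)
  smul_mem {i j s x} hs hx := (add_assoc i j a) ▸ E.smul_mem hs hx

/-- The twist functor `E ↦ E(a)`. -/
def twist (a : M) : FGGrMod 𝒜 ⥤ FGGrMod 𝒜 where
  obj E := twistObj a E
  map f := ⟨f.toLin, fun h => f.map_mem h⟩

def isoOfLinearEquiv {E F : FGGrMod 𝒜} (e : E.carrier ≃ₗ[S] F.carrier)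
    (he : ∀ m x, x ∈ E.grading m ↔ e x ∈ F.grading m) : E ≅ F where
  hom := ⟨e.toLinearMap, fun h => (he _ _).1 h⟩
  inv := ⟨e.symm.toLinearMap, fun h => (he _ _).2 (by simpa using h)⟩
  hom_inv_id := by ext x; simp
  inv_hom_id := by ext x; simp

def twistZero : twist (0 : M) ≅ 𝟭 (FGGrMod 𝒜) :=
  NatIso.ofComponents (fun E => isoOfLinearEquiv (E := (twist 0).obj E) (F := E)
    (LinearEquiv.refl S E.carrier) (fun m x => by
      change x ∈ E.grading (m + 0) ↔ x ∈ E.grading m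
      rw [add_zero])) (fun _ => rfl)

def twistAdd (a b : M) : twist (a + b) ≅ (twist a ⋙ twist b : FGGrMod 𝒜 ⥤ FGGrMod 𝒜) :=
  NatIso.ofComponents (fun E => isoOfLinearEquiv (E := (twist (a + b)).obj E)
    (F := (twist b).obj ((twist a).obj E)) (LinearEquiv.refl S E.carrier) (fun m x => by
      change x ∈ E.grading (m + (a + b)) ↔ x ∈ E.grading (m + b + a)
      rw [add_assoc, add_comm b a])) (fun _ => rfl)

theorem eqToHom_twist {a b : M} (h : a = b) (E : FGGrMod 𝒜)
    (h' : (twist a).obj E = (twist b).obj E) (x : E.carrier) :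
    (eqToHom h').toLin x = x := by
  subst h; rfl

instance (a : M) : (twist a : FGGrMod 𝒜 ⥤ FGGrMod 𝒜).Additive where
  map_add := rfl

instance (a : M) : (twist a : FGGrMod 𝒜 ⥤ FGGrMod 𝒜).IsEquivalence where
  faithful := ⟨fun h => by ext x; exact congr($(h).toLin x)⟩
  full := ⟨fun {E F} g => ⟨⟨g.toLin, fun {m x} h => by
    have := g.map_mem (m := m - a) (x := x)
    change x ∈ E.grading (m - a + a) → g.toLin x ∈ F.grading (m - a + a) at this
    rw [sub_add_cancel] at this
    exact this h⟩, rfl⟩⟩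
  essSurj := ⟨fun E => ⟨(twist (-a)).obj E, ⟨(twistAdd (-a) a).symm.app E ≪≫
    eqToIso (by rw [neg_add_cancel]) ≪≫ twistZero.app E⟩⟩⟩

variable (L : AddSubgroup M)

/-- The action of the subgroup `L` on graded modules by the twists `E ↦ E(l)`. -/
noncomputable instance hasShift : HasShift (FGGrMod 𝒜) L :=
  hasShiftMk _ _
    { F l := twist (l : M)
      zero := twistZero
      add a b := twistAdd (a : M) b
      assoc_hom_app a b c E := by
        ext x
        exact (eqToHom_twist (congrArg Subtype.val (add_assoc a b c)) E _ x).symm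
      zero_add_hom_app a E := by
        ext x
        exact (eqToHom_twist (congrArg Subtype.val (zero_add a)) E _ x).symm
      add_zero_hom_app a E := by
        ext x
        exact (eqToHom_twist (congrArg Subtype.val (add_zero a)) E _ x).symm }

end twist

section complexes
variable [IsNoetherianRing S] (L : AddSubgroup M)

/-- The termwise action of `L` on complexes of graded modules. -/
noncomputable instance hasShiftComplex : HasShift (CochainComplex (FGGrMod 𝒜) ℤ) L :=
  hasShiftMk _ _
    { F l := (twist (l : M)).mapHomologicalComplex (ComplexShape.up ℤ)
      zero := NatIso.mapHomologicalComplex twistZero _ ≪≫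
        Functor.mapHomologicalComplexIdIso _ _
      add a b := NatIso.mapHomologicalComplex (twistAdd (a : M) b) _
      assoc_hom_app a b c K := by
        ext n x
        have h := eqToHom_twist (congrArg Subtype.val (add_assoc a b c)) (K.X n) (by
          rw [congrArg Subtype.val (add_assoc a b c)]) x
        simp only [HomologicalComplex.comp_f, HomologicalComplex.eqToHom_f]
        exact h.symm
      zero_add_hom_app a K := by
        ext n x
        have h := eqToHom_twist (congrArg Subtype.val (zero_add a)) (K.X n) (by
          rw [congrArg Subtype.val (zero_add a)]) x
        simp only [HomologicalComplex.comp_f, HomologicalComplex.eqToHom_f]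
        exact h.symm
      add_zero_hom_app a K := by
        ext n x
        have h := eqToHom_twist (congrArg Subtype.val (add_zero a)) (K.X n) (by
          rw [congrArg Subtype.val (add_zero a)]) x
        simp only [HomologicalComplex.comp_f, HomologicalComplex.eqToHom_f]
        exact h.symm }

noncomputable instance : HasDerivedCategory (FGGrMod 𝒜) := HasDerivedCategory.standard _

/-- The action of `L` on the derived category, by the functors induced by the (exact) twists. -/
noncomputable instance hasShiftDerived : HasShift (DerivedCategory (FGGrMod 𝒜)) L :=
  have := Localization.full_whiskeringLeft DerivedCategory.Q
    (HomologicalComplex.quasiIso (FGGrMod 𝒜) (ComplexShape.up ℤ)) (DerivedCategory (FGGrMod 𝒜))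
  have := Localization.faithful_whiskeringLeft DerivedCategory.Q
    (HomologicalComplex.quasiIso (FGGrMod 𝒜) (ComplexShape.up ℤ)) (DerivedCategory (FGGrMod 𝒜))
  HasShift.induced DerivedCategory.Q L (fun l => (twist (l : M)).mapDerivedCategory)
    (fun l => (twist (l : M)).mapDerivedCategoryFactors)

noncomputable instance (l : L) : (shiftFunctor (DerivedCategory (FGGrMod 𝒜)) l).CommShift ℤ :=
  inferInstanceAs ((twist (l : M)).mapDerivedCategory.CommShift ℤ)

instance (l : L) : (shiftFunctor (DerivedCategory (FGGrMod 𝒜)) l).IsTriangulated :=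
  inferInstanceAs ((twist (l : M)).mapDerivedCategory.IsTriangulated)

instance : (DerivedCategory.TStructure.t (C := FGGrMod 𝒜)).bounded.IsStableUnderShift L where
  isStableUnderShiftBy l := ⟨by
    rintro X ⟨⟨a, ⟨K, e, h⟩⟩, ⟨b, ⟨K', e', h'⟩⟩⟩
    refine ⟨⟨a, ⟨⟨((twist (l : M)).mapHomologicalComplex _).obj K, ?_, ?_⟩⟩⟩,
      ⟨b, ⟨⟨((twist (l : M)).mapHomologicalComplex _).obj K', ?_, ?_⟩⟩⟩⟩
    · exact (twist (l : M)).mapDerivedCategory.mapIso e ≪≫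
        (twist (l : M)).mapDerivedCategoryFactors.app K
    · rw [CochainComplex.isStrictlyGE_iff] at h ⊢
      exact fun i hi => (twist (l : M)).map_isZero (h i hi)
    · exact (twist (l : M)).mapDerivedCategory.mapIso e' ≪≫
        (twist (l : M)).mapDerivedCategoryFactors.app K'
    · rw [CochainComplex.isStrictlyLE_iff] at h' ⊢
      exact fun i hi => (twist (l : M)).map_isZero (h' i hi)⟩

end complexes

end FGGrMod
end

namespace CategoryTheory
section fullsub
open ObjectProperty
variable {C : Type*} [Category* C] [HasZeroObject C] [HasShift C ℤ]
  [Preadditive C] [∀ n : ℤ, (shiftFunctor C n).Additive] [Pretriangulated C]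
  {A : Type*} [AddMonoid A] [HasShift C A]

@[reducible] noncomputable def commShiftFullSub (P : ObjectProperty C) [P.IsTriangulated] [P.IsStableUnderShift A] (a : A) 
    [(shiftFunctor C a).CommShift ℤ] :
    (shiftFunctor P.FullSubcategory a).CommShift ℤ :=
  Functor.CommShift.ofComp (P.ι.commShiftIso a) ℤ

theorem isTriangulatedFullSub (P : ObjectProperty C) [P.IsTriangulated] [P.IsStableUnderShift A] (a : A) 
    [(shiftFunctor C a).CommShift ℤ] [(shiftFunctor C a).IsTriangulated] :
    letI := commShiftFullSub P a
    (shiftFunctor P.FullSubcategory a).IsTriangulated := by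
  let := commShiftFullSub P a
  have : NatTrans.CommShift (P.ι.commShiftIso a).hom ℤ := Functor.CommShift.ofComp_compatibility _ _
  rw [Functor.isTriangulated_iff_comp_right (P.ι.commShiftIso a)]
  infer_instance

theorem isCompatibleWithShift_trW {A : Type*} [AddGroup A] [HasShift C A] (P : ObjectProperty C) [P.IsTriangulated] [P.IsStableUnderShift A]
    [∀ a : A, (shiftFunctor C a).CommShift ℤ] [∀ a : A, (shiftFunctor C a).IsTriangulated] :
    P.trW.IsCompatibleWithShift A where
  condition a := by
    have key (a : A) {X Y : C} (f : X ⟶ Y) (hf : P.trW f) : P.trW ((shiftFunctor C a).map f) := by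
      obtain ⟨Z, g, h, hT, hZ⟩ := hf
      exact ⟨_, _, _, (shiftFunctor C a).map_distinguished _ hT, P.le_shift a _ hZ⟩
    ext X Y f
    refine ⟨fun hf => ?_, key a f⟩
    exact (P.trW.arrow_mk_iso_iff (Arrow.isoOfNatIso (shiftEquiv C a).unitIso (Arrow.mk f))).2
      (key (-a) _ hf)

variable (W : MorphismProperty C) [W.IsCompatibleWithTriangulation] [W.HasLeftCalculusOfFractions]
  [W.HasRightCalculusOfFractions]
  [W.IsCompatibleWithShift A] 

@[reducible] noncomputable def commShiftLoc (a : A) [(shiftFunctor C a).CommShift ℤ] :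
    (shiftFunctor W.Localization a).CommShift ℤ :=
  letI : Localization.Lifting W.Q W (shiftFunctor C a ⋙ W.Q) (shiftFunctor W.Localization a) :=
    ⟨(W.Q.commShiftIso a).symm⟩
  Functor.commShiftOfLocalization W.Q W ℤ (shiftFunctor C a ⋙ W.Q) (shiftFunctor W.Localization a)

theorem isTriangulatedLoc (a : A) [(shiftFunctor C a).CommShift ℤ]
   [(shiftFunctor C a).IsTriangulated] :
    letI := commShiftLoc W a
    (shiftFunctor W.Localization a).IsTriangulated := by
  let := commShiftLoc W a
  let inst : Localization.Lifting W.Q W (shiftFunctor C a ⋙ W.Q) (shiftFunctor W.Localization a) :=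
    ⟨(W.Q.commShiftIso a).symm⟩
  have : NatTrans.CommShift (W.Q.commShiftIso a).symm.hom ℤ :=
    NatTrans.commShift_iso_hom_of_localization W.Q W ℤ (shiftFunctor C a ⋙ W.Q) (shiftFunctor W.Localization a)
  have := Localization.essSurj_mapArrow W.Q W
  exact Functor.isTriangulated_of_precomp_iso (W.Q.commShiftIso a).symm

end fullsub
end CategoryTheory

namespace DerivedCategory
open CategoryTheory Pretriangulated ZeroObject
universe w
variable (C : Type u) [Category.{v} C] [Abelian C] [HasDerivedCategory.{w} C]

/-- Perfect objects: those isomorphic in the derived category to a bounded complex of projective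
objects. For the category of finitely generated graded modules, the projective objects are the
finitely generated graded projective modules. -/
def perfect : ObjectProperty (DerivedCategory C) := fun X =>
  ∃ K : CochainComplex C ℤ, (∃ a, K.IsStrictlyGE a) ∧ (∃ b, K.IsStrictlyLE b) ∧
    (∀ i, Projective (K.X i)) ∧ Nonempty (X ≅ Q.obj K)

instance : (perfect C).IsClosedUnderIsomorphisms where
  of_iso := by
    rintro X Y e ⟨K, h₁, h₂, h₃, ⟨e'⟩⟩
    exact ⟨K, h₁, h₂, h₃, ⟨e.symm ≪≫ e'⟩⟩

instance : (perfect C).ContainsZero where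
  exists_zero := ⟨Q.obj 0, Q.map_isZero (isZero_zero _), 0,
    ⟨0, by rw [CochainComplex.isStrictlyGE_iff]; exact fun i _ => (HomologicalComplex.eval C _ i).map_isZero (isZero_zero _)⟩,
    ⟨0, by rw [CochainComplex.isStrictlyLE_iff]; exact fun i _ => (HomologicalComplex.eval C _ i).map_isZero (isZero_zero _)⟩,
    fun i => ((HomologicalComplex.eval C _ i).map_isZero (isZero_zero _)).projective, ⟨Iso.refl _⟩⟩

instance : (perfect C).IsStableUnderShift ℤ where
  isStableUnderShiftBy n := ⟨by
    rintro X ⟨K, ⟨a, ha⟩, ⟨b, hb⟩, h₃, ⟨e⟩⟩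
    exact ⟨K⟦n⟧, ⟨a - n, K.isStrictlyGE_shift a n _ (by lia)⟩, ⟨b - n, K.isStrictlyLE_shift b n _ (by lia)⟩,
      fun i => h₃ (i + n), ⟨(shiftFunctor _ n).mapIso e ≪≫ (Q.commShiftIso n).symm.app K⟩⟩⟩

instance : (perfect C).IsTriangulatedClosed₃ := .mk' (by
  rintro T hT ⟨K, ⟨a, ha⟩, ⟨b, hb⟩, hK, ⟨e⟩⟩ ⟨K', ⟨a', ha'⟩, ⟨b', hb'⟩, hK', ⟨e'⟩⟩
  have := K.isKProjective_of_projective b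
  obtain ⟨φ, hφ⟩ : ∃ φ : K ⟶ K', Q.map φ = e.inv ≫ T.mor₁ ≫ e'.hom := by
    obtain ⟨g, hg⟩ := (CochainComplex.IsKProjective.Qh_map_bijective K
      ((HomotopyCategory.quotient _ _).obj K')).2 ((quotientCompQhIso C).hom.app K ≫
        (e.inv ≫ T.mor₁ ≫ e'.hom) ≫ (quotientCompQhIso C).inv.app K')
    obtain ⟨φ, rfl⟩ := (HomotopyCategory.quotient _ _).map_surjective g
    refine ⟨φ, ?_⟩
    rw [← cancel_epi ((quotientCompQhIso C).hom.app K), ← quotientCompQhIso_hom_naturality, hg]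
    simp
  obtain ⟨f, -, -⟩ := exists_iso_of_arrow_iso T _ hT (mappingCone_triangle_distinguished φ)
    (Arrow.isoMk e e' (by
      change e.hom ≫ Q.map φ = T.mor₁ ≫ e'.hom
      simp [hφ]))
  have hX (i : ℤ) := HomologicalComplex.homotopyCofiber.XIsoBiprod φ i (i + 1) rfl
  refine ⟨CochainComplex.mappingCone φ, ⟨min (a - 1) a', ?_⟩, ⟨max (b - 1) b', ?_⟩, fun i => ?_,
    ⟨Triangle.π₃.mapIso f⟩⟩
  · rw [CochainComplex.isStrictlyGE_iff] at ha ha' ⊢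
    intro i hi
    refine IsZero.of_iso ?_ (hX i)
    rw [biprod_isZero_iff]
    exact ⟨ha _ (by lia), ha' _ (by lia)⟩
  · rw [CochainComplex.isStrictlyLE_iff] at hb hb' ⊢
    intro i hi
    refine IsZero.of_iso ?_ (hX i)
    rw [biprod_isZero_iff]
    exact ⟨hb _ (by lia), hb' _ (by lia)⟩
  · exact Projective.of_iso (hX i).symm inferInstance)

instance : (perfect C).IsTriangulated where
  toIsTriangulatedClosed₂ := ObjectProperty.IsTriangulatedClosed₂.of_isTriangulatedClosed₃

end DerivedCategory

section sing
open CategoryTheory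
variable {S : Type u} [Ring S] [IsNoetherianRing S] {M : Type v} [AddCommGroup M]

/-- The bounded derived category `D^b(gr mod-S)` of finitely generated graded modules. -/
abbrev GrDb (𝒜 : M → AddSubgroup S) := DerivedCategory.Bounded (FGGrMod 𝒜)

/-- The subcategory of perfect complexes in `D^b(gr mod-S)`. -/
abbrev grPerf (𝒜 : M → AddSubgroup S) : ObjectProperty (GrDb 𝒜) :=
  (DerivedCategory.perfect (FGGrMod 𝒜)).inverseImage DerivedCategory.Bounded.ι

/-- The graded singularity category: the Verdier quotient of `D^b(gr mod-S)` by the perfect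
complexes, i.e. its localization at the morphisms whose cone is perfect. -/
abbrev GrDsg (𝒜 : M → AddSubgroup S) := (grPerf 𝒜).trW.Localization

variable (𝒜 : M → AddSubgroup S) (L : AddSubgroup M)


instance : (grPerf 𝒜).IsStableUnderShift L where
  isStableUnderShiftBy l := ⟨by
    rintro X ⟨K, ⟨a, ha⟩, ⟨b, hb⟩, h₃, ⟨e⟩⟩
    refine ⟨((FGGrMod.twist (l : M)).mapHomologicalComplex _).obj K, ⟨a, ?_⟩, ⟨b, ?_⟩, fun i => ?_,
      ⟨?_⟩⟩
    · rw [CochainComplex.isStrictlyGE_iff] at ha ⊢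
      exact fun i hi => (FGGrMod.twist (l : M)).map_isZero (ha i hi)
    · rw [CochainComplex.isStrictlyLE_iff] at hb ⊢
      exact fun i hi => (FGGrMod.twist (l : M)).map_isZero (hb i hi)
    · exact ((FGGrMod.twist (l : M)).asEquivalence.map_projective_iff (K.X i)).2 (h₃ i)
    · exact ((DerivedCategory.Bounded.ι.commShiftIso l).app X) ≪≫
        (FGGrMod.twist (l : M)).mapDerivedCategory.mapIso e ≪≫
        (FGGrMod.twist (l : M)).mapDerivedCategoryFactors.app K⟩

noncomputable instance (l : L) : (shiftFunctor (GrDb 𝒜) l).CommShift ℤ := commShiftFullSub _ l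
instance (l : L) : (shiftFunctor (GrDb 𝒜) l).IsTriangulated := isTriangulatedFullSub _ l
instance : (grPerf 𝒜).trW.IsCompatibleWithShift L := isCompatibleWithShift_trW _
noncomputable instance (l : L) : (shiftFunctor (GrDsg 𝒜) l).CommShift ℤ := commShiftLoc _ l
instance (l : L) : (shiftFunctor (GrDsg 𝒜) l).IsTriangulated := isTriangulatedLoc _ l

end sing

section coarsen
variable {S : Type u} [Ring S] {M : Type v} [AddCommGroup M]

/-- The grading of `S` by `M ⧸ L` whose piece of degree `q` is the (direct) sum of the `𝒜 m` over
all `m` in the coset `q`. -/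
def coarsen (𝒜 : M → AddSubgroup S) (L : AddSubgroup M) (q : M ⧸ L) : AddSubgroup S :=
  ⨆ m : {m : M // (m : M ⧸ L) = q}, 𝒜 m

variable (𝒜 : M → AddSubgroup S) (L : AddSubgroup M)

theorem mem_coarsen {m : M} {s : S} (h : s ∈ 𝒜 m) : s ∈ coarsen 𝒜 L (m : M ⧸ L) :=
  le_iSup (fun m' : {m' : M // (m' : M ⧸ L) = m} => 𝒜 m') ⟨m, rfl⟩ h

theorem coarsen_induction {q : M ⧸ L} {p : S → Prop} (h : ∀ m : M, (m : M ⧸ L) = q → ∀ s ∈ 𝒜 m, p s)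
    (h0 : p 0) (ha : ∀ s t, p s → p t → p (s + t)) {s : S} (hs : s ∈ coarsen 𝒜 L q) : p s :=
  AddSubgroup.iSup_induction _ (C := p) hs (fun m s hs => h m m.2 s hs) h0 ha

open Classical in
theorem coarsen_isInternal [DecidableEq M] [GradedRing 𝒜] : DirectSum.IsInternal (coarsen 𝒜 L) := by
  let p (q : M ⧸ L) : S →+ S := (DirectSum.coeAddMonoidHom 𝒜).comp
    ((DFinsupp.filterAddMonoidHom (fun i => 𝒜 i) (fun i : M => (i : M ⧸ L) = q)).comp
      (DirectSum.decomposeAddEquiv 𝒜).toAddMonoidHom)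
  have hp (q : M ⧸ L) (m : M) (s : S) (hs : s ∈ 𝒜 m) : p q s = if (m : M ⧸ L) = q then s else 0 := by
    have : DirectSum.decompose 𝒜 s = DFinsupp.single m ⟨s, hs⟩ := DirectSum.decompose_of_mem _ hs
    change DirectSum.coeAddMonoidHom 𝒜 (DFinsupp.filter _ (DirectSum.decompose 𝒜 s)) = _
    rw [this, DFinsupp.filter_single]
    split_ifs
    · exact DirectSum.coeAddMonoidHom_of 𝒜 m ⟨s, hs⟩
    · simp
  refine DirectSum.isInternal_of_projections _ p ?_ ?_ ?_ ?_
  · intro q s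
    rw [← DirectSum.sum_support_decompose 𝒜 s, map_sum]
    refine sum_mem fun m _ => ?_
    rw [hp q m _ (SetLike.coe_mem _)]
    split_ifs with h
    · exact h ▸ mem_coarsen 𝒜 L (SetLike.coe_mem _)
    · exact zero_mem _
  · intro q s hs
    refine coarsen_induction 𝒜 L (p := fun s => p q s = s) ?_ (map_zero _) ?_ hs
    · intro m hm s hs
      rw [hp q m s hs, if_pos hm]
    · intro s t h h'
      rw [map_add, h, h']
  · intro q r hqr s hs
    refine coarsen_induction 𝒜 L (p := fun s => p r s = 0) ?_ (map_zero _) ?_ hs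
    · intro m hm s hs
      rw [hp r m s hs, if_neg (hm ▸ hqr)]
    · intro s t h h'
      rw [map_add, h, h', add_zero]
  · intro s
    refine ⟨(DirectSum.decompose 𝒜 s).support.image (fun m : M => (m : M ⧸ L)), ?_⟩
    have (q : M ⧸ L) : p q s = ∑ m ∈ (DirectSum.decompose 𝒜 s).support.filter
        (fun m : M => (m : M ⧸ L) = q), (DirectSum.decompose 𝒜 s m : S) := by
      conv_lhs => rw [← DirectSum.sum_support_decompose 𝒜 s, map_sum]
      rw [Finset.sum_filter]
      exact Finset.sum_congr rfl fun m _ => hp q m _ (SetLike.coe_mem _)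
    simp only [this]
    rw [Finset.sum_fiberwise_of_maps_to (fun m hm => Finset.mem_image_of_mem _ hm)]
    exact DirectSum.sum_support_decompose 𝒜 s

open Classical in
/-- The coarsened grading is a ring grading. -/
noncomputable instance [DecidableEq M] [GradedRing 𝒜] : GradedRing (coarsen 𝒜 L) where
  one_mem := mem_coarsen 𝒜 L (SetLike.GradedOne.one_mem)
  mul_mem := by
    intro q r s t hs ht
    refine coarsen_induction 𝒜 L (p := fun s => s * t ∈ coarsen 𝒜 L (q + r)) ?_ ?_ ?_ hs
    · rintro m rfl s hs
      refine coarsen_induction 𝒜 L (p := fun t => s * t ∈ coarsen 𝒜 L (m + r)) ?_ ?_ ?_ ht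
      · rintro m' rfl t ht
        exact mem_coarsen 𝒜 L (SetLike.GradedMul.mul_mem hs ht)
      · simp
      · intro t t' h h'
        rw [mul_add]; exact add_mem h h'
    · simp
    · intro s s' h h'
      rw [add_mul]; exact add_mem h h'
  toDecomposition := (coarsen_isInternal 𝒜 L).chooseDecomposition

end coarsen

namespace CategoryTheory
open scoped DirectSum

/-- The orbit category `T / Γ` of an action of `Γ` on `T`; it has the same objects as `T`.
An action of `Γ` by autoequivalences `g(B) = B⟦g⟧` is an instance of `HasShift T Γ`. -/
structure OrbitCategory (T : Type*) (Γ : Type*) where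
  obj : T

namespace OrbitCategory
variable {T : Type*} [Category* T] [Preadditive T] {Γ : Type*} [AddCommGroup Γ] [HasShift T Γ]
  [∀ g : Γ, (shiftFunctor T g).Additive]

open Classical in
/-- Composition in the orbit category: for `f : A ⟶ a(B)` and `k : B ⟶ b(C)` it is
`a(k) ∘ f : A ⟶ a(b(C)) ≅ (b + a)(C)`, extended biadditively. -/
noncomputable def compHom (A B C : T) :
    (⨁ g : Γ, ShiftedHom A B g) →+ (⨁ g : Γ, ShiftedHom B C g) →+ ⨁ g : Γ, ShiftedHom A C g :=
  DirectSum.toAddMonoid fun a => AddMonoidHom.flip <| DirectSum.toAddMonoid fun b =>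
    AddMonoidHom.mk' (fun k => AddMonoidHom.mk'
      (fun f => DirectSum.of (fun g : Γ => ShiftedHom A C g) (b + a) (f.comp k rfl))
      (fun f f' => by rw [ShiftedHom.add_comp, map_add]))
      (fun k k' => by
        ext f
        simp [ShiftedHom.comp_add])

open Classical in
theorem compHom_of {A B C : T} {a b c : Γ} (f : ShiftedHom A B a) (k : ShiftedHom B C b)
    (h : b + a = c) :
    compHom A B C (DirectSum.of (fun g : Γ => ShiftedHom A B g) a f) (DirectSum.of (fun g : Γ => ShiftedHom B C g) b k) =
      DirectSum.of (fun g : Γ => ShiftedHom A C g) c (f.comp k h) := by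
  subst h
  simp [compHom]

open Classical in
/-- Morphisms from `A` to `B` in the orbit category are `⨁ g, Hom(A, g(B))`. -/
noncomputable instance : Category (OrbitCategory T Γ) where
  Hom A B := ⨁ g : Γ, ShiftedHom A.obj B.obj g
  id A := DirectSum.of (fun g : Γ => ShiftedHom A.obj A.obj g) 0 (ShiftedHom.mk₀ 0 rfl (𝟙 A.obj))
  comp {A B C} f k := compHom A.obj B.obj C.obj f k
  id_comp {A B} f := by
    induction f using DirectSum.induction_on with
    | zero => simp
    | of a f => rw [compHom_of _ _ (add_zero a), ShiftedHom.mk₀_id_comp]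
    | add f f' h h' => rw [map_add, h, h']
  comp_id {A B} f := by
    induction f using DirectSum.induction_on with
    | zero => simp
    | of a f => rw [compHom_of _ _ (zero_add a), ShiftedHom.comp_mk₀_id]
    | add f f' h h' => rw [map_add, AddMonoidHom.add_apply, h, h']
  assoc {A B C D} f k l := by
    induction f using DirectSum.induction_on with
    | zero => simp
    | add f f' h h' => simp only [map_add, AddMonoidHom.add_apply, h, h']
    | of a f =>
      induction k using DirectSum.induction_on with
      | zero => simp
      | add f f' h h' => simp only [map_add, AddMonoidHom.add_apply, h, h']
      | of b k =>
        induction l using DirectSum.induction_on with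
        | zero => simp
        | add f f' h h' => simp only [map_add, h, h']
        | of c l =>
          rw [compHom_of _ _ rfl, compHom_of _ _ rfl, compHom_of _ _ rfl,
            compHom_of _ _ (add_assoc c b a), ShiftedHom.comp_assoc f k l rfl rfl (add_assoc c b a)]

noncomputable instance : Preadditive (OrbitCategory T Γ) where
  homGroup A B := inferInstanceAs (AddCommGroup (⨁ g : Γ, ShiftedHom A.obj B.obj g))
  add_comp A B C f f' k := by
    exact congr($((compHom A.obj B.obj C.obj).map_add f f') k)
  comp_add A B C f k k' := (compHom A.obj B.obj C.obj f).map_add k k'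
end OrbitCategory

/-- Let `Γ` act by triangulated autoequivalences on the triangulated category `T`. Then `T` is
a `Γ`-cover of the triangulated category `S` if there is a fully faithful (additive) functor
`F : T / Γ ⥤ S` such that every object of `S` is a direct summand of an object of the essential
image of `F`. -/
def IsCover (Γ T S : Type*) [AddCommGroup Γ]
    [Category* T] [HasZeroObject T] [Preadditive T] [HasShift T ℤ]
    [∀ n : ℤ, (shiftFunctor T n).Additive] [Pretriangulated T] [IsTriangulated T]
    [HasShift T Γ] [∀ g : Γ, (shiftFunctor T g).CommShift ℤ]
    [∀ g : Γ, (shiftFunctor T g).IsTriangulated]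
    [Category* S] [HasZeroObject S] [Preadditive S] [HasShift S ℤ]
    [∀ n : ℤ, (shiftFunctor S n).Additive] [Pretriangulated S] [IsTriangulated S] : Prop :=
  ∃ F : OrbitCategory T Γ ⥤ S, F.Additive ∧ F.Full ∧ F.Faithful ∧
    ∀ Y : S, ∃ (Y' : S) (X : OrbitCategory T Γ), Nonempty (Y ⊞ Y' ≅ F.obj X)

end CategoryTheory

/-!
Write `Φ` for the functor that coarsens an `M`-grading to an `M ⧸ L`-grading, and `Ψ` for the
functor that sends an `M ⧸ L`-graded module `E` to the `M`-graded module with component `E_(m+L)` in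
degree `m`. These functors are adjoint to each other on both sides (`coarseningAdjSpread`,
`spreadAdjCoarsening`); hence they are exact and preserve projective objects, and they induce
functors between the singularity categories.

Since `(ΨΦE)_m = ⨁ l, E_(m+l)`, the functor `ΨΦ` is the sum of the twists by the elements of `L`, and
by adjunction `Hom(ΦE, ΦF) = Hom(E, ΨΦF) = ⨁ l, Hom(E, F(l))`: this is full faithfulness on the orbit
category. The composite `F → ΦΨF → F` of the two adjunction morphisms is multiplication by the order
of `L`, which is invertible, so `F` is a direct summand of `Φ(ΨF)`.

All that the argument needs are a few natural transformations between composites of `Φ` and `Ψ` and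
identities between them; they are collected in the structure `CoverData`, and `CoverData.isCover`
deduces the covering property from them. Such data are established for complexes of graded modules,
where everything is checked on homogeneous elements (`complexCoverData`), are restricted to the
complexes with bounded cohomology (`CoverData.restrict`), and are carried over to the singularity
categories by `CoverData.transfer`. For the last step, a natural transformation between functors on
the singularity category is the same as one between their restrictions to complexes (class
`LiftsNatTrans`), and an identity between natural transformations can be tested on complexes.
-/


/-! ### Coarsening the grading of a module -/

namespace FGGrMod
open DirectSum

section general
variable {S : Type u} [Ring S] {M : Type v} [AddCommGroup M] {𝒜 : M → AddSubgroup S}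

theorem addHom_ext (E : FGGrMod 𝒜) {G : Type*} [AddCommMonoid G] {f g : E.carrier →+ G}
    (h : ∀ m, ∀ x ∈ E.grading m, f x = g x) : f = g := by
  ext x
  obtain ⟨s, hs⟩ := E.exists_sum_proj x
  rw [← hs, map_sum, map_sum]
  exact Finset.sum_congr rfl fun m _ => h m _ (E.proj_mem m x)

theorem proj_smul (E : FGGrMod 𝒜) {a : M} {s : S} (hs : s ∈ 𝒜 a) (m : M) (x : E.carrier) :
    E.proj (a + m) (s • x) = s • E.proj m x := by
  have h : (E.proj (a + m)).comp (DistribSMul.toAddMonoidHom E.carrier s) =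
      (DistribSMul.toAddMonoidHom E.carrier s).comp (E.proj m) := by
    refine E.addHom_ext fun k x hx => ?_
    change E.proj (a + m) (s • x) = s • E.proj m x
    by_cases hk : k = m
    · subst hk
      rw [E.proj_same hx, E.proj_same (E.smul_mem hs hx)]
    · rw [E.proj_ne hk hx, E.proj_ne (by simpa using hk) (E.smul_mem hs hx), smul_zero]
  exact DFunLike.congr_fun h x

theorem map_eq_of_homogeneous {E F : FGGrMod 𝒜} {f g : E ⟶ F}
    (h : ∀ m, ∀ x ∈ E.grading m, f.toLin x = g.toLin x) : f = g := by
  ext x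
  exact DFunLike.congr_fun
    (E.addHom_ext (f := f.toLin.toAddMonoidHom) (g := g.toLin.toAddMonoidHom) h) x

open Classical in
/-- The additive map out of a graded module that is given by `g m` on the component of
degree `m`. -/
noncomputable def desc (E : FGGrMod 𝒜) {G : Type*} [AddCommMonoid G] (g : M → E.carrier →+ G) :
    E.carrier →+ G :=
  (DirectSum.toAddMonoid fun m => (g m).comp (E.grading m).subtype).comp
    (AddEquiv.ofBijective (DirectSum.coeAddMonoidHom E.grading) E.isInternal).symm.toAddMonoidHom

theorem desc_of_mem (E : FGGrMod 𝒜) {G : Type*} [AddCommMonoid G] (g : M → E.carrier →+ G) {m : M}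
    {x : E.carrier} (hx : x ∈ E.grading m) : E.desc g x = g m x := by
  classical
  have : (AddEquiv.ofBijective (DirectSum.coeAddMonoidHom E.grading) E.isInternal).symm x =
      DirectSum.of (fun i => E.grading i) m ⟨x, hx⟩ := by
    rw [AddEquiv.symm_apply_eq]
    exact (DirectSum.coeAddMonoidHom_of E.grading m ⟨x, hx⟩).symm
  unfold desc
  simp [this]

theorem desc_smul (E : FGGrMod 𝒜) {G : Type*} [AddCommGroup G] [Module S G]
    (g : M → E.carrier →+ G) {s : S}
    (h : ∀ m, ∀ x ∈ E.grading m, E.desc g (s • x) = s • g m x) (x : E.carrier) :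
    E.desc g (s • x) = s • E.desc g x := by
  refine DFunLike.congr_fun (E.addHom_ext
    (f := (E.desc g).comp (DistribSMul.toAddMonoidHom E.carrier s))
    (g := (DistribSMul.toAddMonoidHom G s).comp (E.desc g)) fun m x hx => ?_) x
  change E.desc g (s • x) = s • E.desc g x
  rw [E.desc_of_mem g hx, h m x hx]

/-- An additive map that commutes with the homogeneous scalars is linear. -/
def linOfHomogeneous (𝒜 : M → AddSubgroup S) [DecidableEq M] [GradedRing 𝒜] {N G : Type*}
    [AddCommGroup N] [Module S N] [AddCommGroup G] [Module S G] (f : N →+ G)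
    (h : ∀ a, ∀ s ∈ 𝒜 a, ∀ x, f (s • x) = s • f x) : N →ₗ[S] G where
  __ := f
  map_smul' s x := by
    classical
    change f (s • x) = s • f x
    rw [← DirectSum.sum_support_decompose 𝒜 s, Finset.sum_smul, Finset.sum_smul, map_sum]
    exact Finset.sum_congr rfl fun a _ => h a _ (SetLike.coe_mem _) x

@[simp] theorem linOfHomogeneous_apply (𝒜 : M → AddSubgroup S) [DecidableEq M] [GradedRing 𝒜]
    {N G : Type*} [AddCommGroup N] [Module S N] [AddCommGroup G] [Module S G] (f : N →+ G)
    (h : ∀ a, ∀ s ∈ 𝒜 a, ∀ x, f (s • x) = s • f x) (x : N) :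
    linOfHomogeneous 𝒜 f h x = f x := rfl

end general

section coarsening
variable {S : Type u} [Ring S] {M : Type v} [AddCommGroup M] {𝒜 : M → AddSubgroup S}
  (L : AddSubgroup M)

theorem isInternal_coarsenObj [DecidableEq (M ⧸ L)] (E : FGGrMod 𝒜) :
    DirectSum.IsInternal fun q : M ⧸ L =>
      (⨆ m : {m : M // (m : M ⧸ L) = q}, E.grading m : AddSubgroup E.carrier) := by
  classical
  have hle (m : M) : E.grading m ≤ ⨆ m' : {m' : M // (m' : M ⧸ L) = m}, E.grading m' :=
    le_iSup (fun m' : {m' : M // (m' : M ⧸ L) = m} => E.grading m') ⟨m, rfl⟩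
  let p (q : M ⧸ L) : E.carrier →+ E.carrier :=
    E.desc fun m => if (m : M ⧸ L) = q then AddMonoidHom.id _ else 0
  have hp (q : M ⧸ L) (m : M) (x) (hx : x ∈ E.grading m) :
      p q x = if (m : M ⧸ L) = q then x else 0 := by
    rw [E.desc_of_mem _ hx]
    split_ifs <;> rfl
  refine DirectSum.isInternal_of_projections _ p (fun q x => ?_) (fun q x hx => ?_)
    (fun q r hqr x hx => ?_) (fun x => ?_)
  · obtain ⟨s, hs⟩ := E.exists_sum_proj x
    rw [← hs, map_sum]
    refine sum_mem fun m _ => ?_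
    rw [hp q m _ (E.proj_mem m x)]
    split_ifs with h
    · subst h
      exact hle m (E.proj_mem m x)
    · exact zero_mem _
  · refine AddSubgroup.iSup_induction _ (C := fun x => p q x = x) hx ?_ (map_zero _) ?_
    · rintro ⟨m, rfl⟩ x hx
      rw [hp _ m x hx, if_pos rfl]
    · intro x y hx hy
      rw [map_add, hx, hy]
  · refine AddSubgroup.iSup_induction _ (C := fun x => p r x = 0) hx ?_ (map_zero _) ?_
    · rintro ⟨m, rfl⟩ x hx
      rw [hp _ m x hx, if_neg hqr]
    · intro x y hx hy
      rw [map_add, hx, hy, add_zero]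
  · obtain ⟨s, hs⟩ := E.exists_sum_proj x
    refine ⟨s.image (fun m : M => (m : M ⧸ L)), ?_⟩
    have key (q : M ⧸ L) : p q x =
        ∑ m ∈ s.filter (fun m : M => (m : M ⧸ L) = q), E.proj m x := by
      conv_lhs => rw [← hs, map_sum]
      rw [Finset.sum_filter]
      exact Finset.sum_congr rfl fun m _ => hp q m _ (E.proj_mem m x)
    simp only [key]
    rw [Finset.sum_fiberwise_of_maps_to (fun m hm => Finset.mem_image_of_mem _ hm)]
    exact hs

/-- A graded module with its grading coarsened from `M` to `M ⧸ L`. It is reducible, like the other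
functors on graded modules below, so that its carrier is recognized as that of `E`. -/
@[reducible] def coarsenObj (E : FGGrMod 𝒜) : FGGrMod (coarsen 𝒜 L) where
  carrier := E.carrier
  grading q := ⨆ m : {m : M // (m : M ⧸ L) = q}, E.grading m
  isInternal := @isInternal_coarsenObj _ _ _ _ _ L (fun _ _ => Classical.propDecidable _) E
  smul_mem := by
    intro q r s x hs hx
    refine coarsen_induction 𝒜 L (p := fun s => s • x ∈ _) ?_ ?_ ?_ hs
    · rintro a rfl s hs
      refine AddSubgroup.iSup_induction _ (C := fun x => s • x ∈ _) hx ?_ ?_ ?_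
      · rintro ⟨m, rfl⟩ x hx
        exact le_iSup (fun m' : {m' : M // (m' : M ⧸ L) = a + m} => E.grading m')
          ⟨a + m, rfl⟩ (E.smul_mem hs hx)
      · simp
      · intro x y hx hy
        rw [smul_add]; exact add_mem hx hy
    · simp
    · intro s t hs ht
      rw [add_smul]; exact add_mem hs ht

theorem mem_coarsenObj (E : FGGrMod 𝒜) {m : M} {x : E.carrier} (hx : x ∈ E.grading m) :
    x ∈ (E.coarsenObj L).grading (m : M ⧸ L) :=
  le_iSup (fun m' : {m' : M // (m' : M ⧸ L) = m} => E.grading m') ⟨m, rfl⟩ hx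

theorem coarsenObj_induction (E : FGGrMod 𝒜) {q : M ⧸ L} {p : E.carrier → Prop}
    (h : ∀ m : M, (m : M ⧸ L) = q → ∀ x ∈ E.grading m, p x) (h0 : p 0)
    (ha : ∀ x y, p x → p y → p (x + y)) {x : E.carrier} (hx : x ∈ (E.coarsenObj L).grading q) :
    p x :=
  AddSubgroup.iSup_induction _ (C := p) hx (fun m x hx => h m m.2 x hx) h0 ha

/-- The functor that coarsens the gradings from `M` to `M ⧸ L`. -/
@[reducible] def coarsening (𝒜 : M → AddSubgroup S) : FGGrMod 𝒜 ⥤ FGGrMod (coarsen 𝒜 L) where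
  obj E := E.coarsenObj L
  map {E F} f := ⟨f.toLin, fun {q x} hx => by
    refine E.coarsenObj_induction L (p := fun x => f.toLin x ∈ (F.coarsenObj L).grading q)
      ?_ ?_ ?_ hx
    · rintro m rfl x hx
      exact F.mem_coarsenObj L (f.map_mem hx)
    · rw [map_zero]; exact zero_mem _
    · intro x y hx hy
      rw [map_add]; exact add_mem hx hy⟩

instance : (coarsening L 𝒜).Additive where
  map_add := rfl

/-- Morphisms out of a coarsened module may be compared on the elements that are homogeneous for
the finer grading. -/
theorem coarsening_hom_ext {E : FGGrMod 𝒜} {F : FGGrMod (coarsen 𝒜 L)}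
    {f g : (coarsening L 𝒜).obj E ⟶ F}
    (h : ∀ m, ∀ x ∈ E.grading m, f.toLin x = g.toLin x) : f = g := by
  ext x
  exact DFunLike.congr_fun
    (E.addHom_ext (f := f.toLin.toAddMonoidHom) (g := g.toLin.toAddMonoidHom) h) x

/-- A morphism out of a coarsened module is a linear map that sends the component of
degree `m` into the component of degree `m + L`. -/
def coarsenHomMk {E : FGGrMod 𝒜} {F : FGGrMod (coarsen 𝒜 L)} (f : E.carrier →ₗ[S] F.carrier)
    (h : ∀ (m : M), ∀ x ∈ E.grading m, f x ∈ F.grading m) : (coarsening L 𝒜).obj E ⟶ F :=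
  ⟨f, fun {q x} hx => by
    refine E.coarsenObj_induction L (p := fun x => f x ∈ F.grading q) ?_ ?_ ?_ hx
    · rintro m rfl x hx
      exact h m x hx
    · rw [map_zero]; exact zero_mem _
    · intro x y hx hy
      rw [map_add]; exact add_mem hx hy⟩

/-- Twisting by an element of `L` does not change the coarsened module; the isomorphism is the
identity on underlying modules. -/
def coarseningTwist (l : L) : twist (l : M) ⋙ coarsening L 𝒜 ≅ coarsening L 𝒜 :=
  NatIso.ofComponents (fun E =>
    { hom := coarsenHomMk L (E := (twist (l : M)).obj E) LinearMap.id (fun m x hx => by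
        have h := E.mem_coarsenObj L (m := m + l) hx
        rwa [show ((m + l : M) : M ⧸ L) = m by simp] at h)
      inv := coarsenHomMk L LinearMap.id (fun m x hx => by
        have h := ((twist (l : M)).obj E).mem_coarsenObj L (m := m - l) (x := x)
          (show x ∈ E.grading (m - l + l) by rwa [sub_add_cancel])
        rwa [show ((m - l : M) : M ⧸ L) = m by
          rw [QuotientAddGroup.mk_sub, (QuotientAddGroup.eq_zero_iff (l : M)).2 l.2,
            sub_zero]] at h)
      hom_inv_id := rfl
      inv_hom_id := rfl }) (fun _ => rfl)

theorem sum_toLin {ι : Type*} {E F : FGGrMod 𝒜} (s : Finset ι) (f : ι → (E ⟶ F)) (x : E.carrier) :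
    Hom.toLin (∑ i ∈ s, f i : E ⟶ F) x = ∑ i ∈ s, (f i).toLin x := by
  classical
  induction s using Finset.induction_on with
  | empty => rfl
  | insert i s hi h =>
    rw [Finset.sum_insert hi, Finset.sum_insert hi, ← h]
    rfl

theorem proj_twist (a : M) (E : FGGrMod 𝒜) (m : M) (x : E.carrier) :
    ((twist a).obj E).proj m x = E.proj (m + a) x := by
  refine DFunLike.congr_fun (addHom_ext ((twist a).obj E) (f := ((twist a).obj E).proj m)
    (g := E.proj (m + a)) fun k x hx => ?_) x
  by_cases h : k = m
  · subst h
    exact (proj_same _ hx).trans (E.proj_same hx).symm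
  · exact (proj_ne _ h hx).trans (E.proj_ne (by simpa using h) hx).symm

variable {L} in
/-- An element of degree `m + L` is the sum of its components of degrees `m + l`. -/
theorem sum_proj_of_mem_coarsenObj [Fintype L] (E : FGGrMod 𝒜) {m : M} {x : E.carrier}
    (hx : x ∈ (E.coarsenObj L).grading (m : M ⧸ L)) : ∑ l : L, E.proj (m + l) x = x := by
  refine E.coarsenObj_induction L (p := fun x => ∑ l : L, E.proj (m + l) x = x) ?_ ?_ ?_ hx
  · intro k hk x hx
    rw [Finset.sum_eq_single (⟨-m + k, QuotientAddGroup.eq.1 hk.symm⟩ : L)]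
    · simpa using E.proj_same hx
    · rintro l - hl
      refine E.proj_ne (fun h => hl (Subtype.ext ?_)) hx
      simp [h]
    · exact fun h => (h (Finset.mem_univ _)).elim
  · simp
  · intro x y hx hy
    simp only [map_add, Finset.sum_add_distrib, hx, hy]

end coarsening

section fiber
variable {M : Type v} [AddCommGroup M] {L : AddSubgroup M} [Finite L]

theorem finite_fiber (q : M ⧸ L) : {m : M | (m : M ⧸ L) = q}.Finite := by
  obtain ⟨m, rfl⟩ := QuotientAddGroup.mk_surjective q
  refine (Set.finite_range fun l : L => m + l).subset fun m' hm' => ?_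
  exact ⟨⟨-m + m', QuotientAddGroup.eq.1 (Eq.symm hm')⟩, by simp⟩

variable (L) in
/-- The elements of a coset of the finite subgroup `L`. -/
noncomputable def fiber (q : M ⧸ L) : Finset M := (finite_fiber q).toFinset

theorem mem_fiber {q : M ⧸ L} {m : M} : m ∈ fiber L q ↔ (m : M ⧸ L) = q := by
  simp [fiber]

theorem fiber_add (a : M) (q : M ⧸ L) :
    fiber L (a + q) = (fiber L q).map (Equiv.addLeft a).toEmbedding := by
  ext m
  rw [Finset.mem_map_equiv, mem_fiber, mem_fiber]
  simp [eq_neg_add_iff_add_eq, eq_comm]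

theorem card_fiber (q : M ⧸ L) : (fiber L q).card = Nat.card L := by
  obtain ⟨m, rfl⟩ := QuotientAddGroup.mk_surjective q
  rw [← Nat.card_eq_finsetCard]
  exact Nat.card_congr
    { toFun k := ⟨-m + k, QuotientAddGroup.eq.1 (mem_fiber.1 k.2).symm⟩
      invFun l := ⟨m + l, mem_fiber.2 (by simp)⟩
      left_inv k := by simp
      right_inv l := by simp }

end fiber
end FGGrMod

/-! ### Spreading a module over the finer grading -/

namespace FGGrMod
open DirectSum

section spread
variable {S : Type u} [Ring S] {M : Type v} [AddCommGroup M] {𝒜 : M → AddSubgroup S}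
  {L : AddSubgroup M}

/-- Restricting the degrees along `M → M ⧸ L` makes the components of an `M ⧸ L`-graded module a
family indexed by `M` on which the homogeneous scalars act. -/
instance gradedSMul (E : FGGrMod (coarsen 𝒜 L)) :
    SetLike.GradedSMul 𝒜 fun m : M => E.grading (m : M ⧸ L) where
  smul_mem _ _ _ _ hs hx := E.smul_mem (mem_coarsen 𝒜 L hs) hx

/-- The direct sum over all `m : M` of the components `E_(m+L)` of an `M ⧸ L`-graded module. -/
def Spread (E : FGGrMod (coarsen 𝒜 L)) : Type (max u v) := ⨁ m : M, E.grading (m : M ⧸ L)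

namespace Spread
variable (E : FGGrMod (coarsen 𝒜 L))

instance : AddCommGroup (Spread E) :=
  inferInstanceAs (AddCommGroup (⨁ m : M, E.grading (m : M ⧸ L)))

/-- A homogeneous scalar of degree `a` maps the summand at `m` to the summand at `a + m`. -/
instance [DecidableEq M] [GradedRing 𝒜] : Module S (Spread E) :=
  GradedModule.isModule 𝒜 fun m : M => E.grading (m : M ⧸ L)

variable [DecidableEq M]

/-- The component of degree `m + L` of an element, placed in the summand at `m`. -/
noncomputable def slot (m : M) : E.carrier →+ Spread E :=
  (DirectSum.of (fun m : M => E.grading (m : M ⧸ L)) m).comp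
    ((E.proj (m : M ⧸ L)).codRestrict (E.grading (m : M ⧸ L)) (E.proj_mem _))

theorem of_eq_slot (m : M) (x : E.grading (m : M ⧸ L)) :
    DirectSum.of (fun m : M => E.grading (m : M ⧸ L)) m x = slot E m x := by
  refine congrArg (DirectSum.of (fun m : M => E.grading (m : M ⧸ L)) m) (Subtype.ext ?_)
  exact (E.proj_same x.2).symm

theorem induction {p : Spread E → Prop} (h0 : p 0)
    (h : ∀ m : M, ∀ x ∈ E.grading (m : M ⧸ L), p (slot E m x))
    (ha : ∀ x y, p x → p y → p (x + y)) (x : Spread E) : p x :=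
  DirectSum.induction_on x h0 (fun m x => of_eq_slot E m x ▸ h m x x.2) ha

/-- The additive map given by `g m` on the summand at `m`. -/
noncomputable def desc {G : Type*} [AddCommMonoid G] (g : M → E.carrier →+ G) : Spread E →+ G :=
  DirectSum.toAddMonoid fun m => (g m).comp (E.grading (m : M ⧸ L)).subtype

theorem desc_slot {G : Type*} [AddCommMonoid G] (g : M → E.carrier →+ G) (m : M) {x : E.carrier}
    (hx : x ∈ E.grading (m : M ⧸ L)) : desc E g (slot E m x) = g m x := by
  have := of_eq_slot E m ⟨x, hx⟩
  dsimp only at this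
  rw [← this]
  exact DirectSum.toAddMonoid_of _ m _

variable [GradedRing 𝒜]

theorem smul_slot {a : M} {s : S} (hs : s ∈ 𝒜 a) (m : M) (x : E.carrier) :
    s • slot E m x = slot E (a + m) (s • x) := by
  have h : s • slot E m x = DirectSum.decompose 𝒜 s •
    (DirectSum.of (fun m : M => E.grading (m : M ⧸ L)) m ⟨E.proj m x, E.proj_mem _ _⟩) := rfl
  rw [h, DirectSum.decompose_of_mem _ hs, DirectSum.Gmodule.of_smul_of]
  refine congrArg (DirectSum.of (fun m : M => E.grading (m : M ⧸ L)) (a + m)) (Subtype.ext ?_)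
  exact (E.proj_smul (mem_coarsen 𝒜 L hs) m x).symm

/-- The copies of the generators of `E` in all the summands generate the direct sum; there are
finitely many nonzero ones, since an element has finitely many components and the cosets of `L` are
finite. -/
theorem finite [Finite L] : Module.Finite S (Spread E) := by
  classical
  obtain ⟨t, ht⟩ := Module.Finite.fg_top (R := S) (M := E.carrier)
  have hfin (x : E.carrier) : (Set.range fun m : M => slot E m x).Finite := by
    obtain ⟨s, hs⟩ := E.exists_sum_proj x
    have hs' : ((fun m : M => (m : M ⧸ L)) ⁻¹' (s : Set (M ⧸ L))).Finite := by
      exact Set.Finite.preimage' s.finite_toSet fun q _ => finite_fiber q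
    refine ((hs'.image fun m : M => slot E m x).insert 0).subset ?_
    rintro _ ⟨m, rfl⟩
    by_cases hm : (m : M ⧸ L) ∈ s
    · exact Or.inr ⟨m, hm, rfl⟩
    · left
      have h0 : E.proj (m : M ⧸ L) x = 0 := by
        conv_lhs => rw [← hs, map_sum]
        exact Finset.sum_eq_zero fun k hk => E.proj_ne (by rintro rfl; exact hm hk) (E.proj_mem k x)
      change DirectSum.of (fun m : M => E.grading (m : M ⧸ L)) m ⟨E.proj m x, _⟩ = 0
      simp only [h0]
      exact map_zero (DirectSum.of (fun m : M => E.grading (m : M ⧸ L)) m)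
  have hgen : (⋃ x ∈ t, Set.range fun m : M => slot E m x).Finite :=
    t.finite_toSet.biUnion fun x _ => hfin x
  refine ⟨⟨hgen.toFinset, ?_⟩⟩
  rw [Set.Finite.coe_toFinset, eq_top_iff]
  set N := Submodule.span S (⋃ x ∈ t, Set.range fun m : M => slot E m x)
  have key (x : E.carrier) : ∀ m : M, slot E m x ∈ N := by
    have hx : x ∈ Submodule.span S (t : Set E.carrier) := ht ▸ Submodule.mem_top
    induction hx using Submodule.span_induction with
    | mem x hx =>
      exact fun m => Submodule.subset_span (Set.mem_biUnion hx ⟨m, rfl⟩)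
    | zero => intro m; rw [map_zero]; exact zero_mem _
    | add x y _ _ hx hy => intro m; rw [map_add]; exact add_mem (hx m) (hy m)
    | smul s x _ hx =>
      intro m
      rw [← DirectSum.sum_support_decompose 𝒜 s, Finset.sum_smul, map_sum]
      refine sum_mem fun a _ => ?_
      have := smul_slot E (SetLike.coe_mem (DirectSum.decompose 𝒜 s a)) (m - a) x
      rw [add_sub_cancel] at this
      rw [← this]
      exact N.smul_mem _ (hx _)
  intro x _
  exact induction E (p := (· ∈ N)) (zero_mem _) (fun m x _ => key x m)
    (fun _ _ => add_mem) x

/-- A finitely generated module is a quotient of some `S ^ n`, so it lives in the universe of `S`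
even when `M` does not. -/
theorem small [Finite L] : Small.{u} (Spread E) := by
  have := finite E
  obtain ⟨n, f, hf⟩ := Module.Finite.exists_fin' S (Spread E)
  exact small_of_surjective hf

end Spread

variable [DecidableEq M] [GradedRing 𝒜] [Finite L]

section obj
variable (E : FGGrMod (coarsen 𝒜 L))

attribute [local instance] Spread.small Spread.finite

/-- The module `⨁ m, E_(m+L)`, in the universe of `E`. -/
def SpreadCarrier : Type u := Shrink.{u} (Spread E)

noncomputable instance : AddCommGroup (SpreadCarrier E) :=
  inferInstanceAs (AddCommGroup (Shrink.{u} (Spread E)))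

noncomputable instance : Module S (SpreadCarrier E) :=
  inferInstanceAs (Module S (Shrink.{u} (Spread E)))

/-- The comparison of the two universe levels. -/
noncomputable def spreadEquiv : SpreadCarrier E ≃ₗ[S] Spread E :=
  Shrink.linearEquiv S (Spread E)

/-- The component of degree `m + L` of an element, placed in the summand at `m`. -/
noncomputable def slot (m : M) : E.carrier →+ SpreadCarrier E :=
  (spreadEquiv E).symm.toAddEquiv.toAddMonoidHom.comp (Spread.slot E m)

/-- The additive map given by `g m` on the summand at `m`. -/
noncomputable def spreadDesc {G : Type*} [AddCommMonoid G] (g : M → E.carrier →+ G) :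
    SpreadCarrier E →+ G :=
  (Spread.desc E g).comp (spreadEquiv E).toAddEquiv.toAddMonoidHom

theorem spreadDesc_slot {G : Type*} [AddCommMonoid G] (g : M → E.carrier →+ G) (m : M)
    {x : E.carrier} (hx : x ∈ E.grading (m : M ⧸ L)) : spreadDesc E g (slot E m x) = g m x := by
  refine Eq.trans ?_ (Spread.desc_slot E g m hx)
  exact congrArg (Spread.desc E g) ((spreadEquiv E).apply_symm_apply _)

theorem smul_slot {a : M} {s : S} (hs : s ∈ 𝒜 a) (m : M) (x : E.carrier) :
    s • slot E m x = slot E (a + m) (s • x) := by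
  refine ((spreadEquiv E).symm.map_smul s _).symm.trans ?_
  exact congrArg (spreadEquiv E).symm (Spread.smul_slot E hs m x)

theorem spread_induction {p : SpreadCarrier E → Prop} (h0 : p 0)
    (h : ∀ m : M, ∀ x ∈ E.grading (m : M ⧸ L), p (slot E m x))
    (ha : ∀ x y, p x → p y → p (x + y)) (x : SpreadCarrier E) : p x := by
  obtain ⟨x, rfl⟩ := (spreadEquiv E).symm.surjective x
  refine Spread.induction E (p := fun x => p ((spreadEquiv E).symm x)) ?_ h ?_ x
  · rwa [map_zero]
  · intro x y hx hy
    rw [map_add]; exact ha _ _ hx hy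

theorem slot_proj (m : M) (x : E.carrier) : slot E m (E.proj m x) = slot E m x := by
  refine congrArg (spreadEquiv E).symm ?_
  refine congrArg (DirectSum.of (fun m : M => E.grading (m : M ⧸ L)) m) (Subtype.ext ?_)
  exact E.proj_same (E.proj_mem _ x)

open Classical in
theorem isInternal_spread : DirectSum.IsInternal fun m : M => (slot E m).range := by
  let p (k : M) : SpreadCarrier E →+ SpreadCarrier E :=
    spreadDesc E fun m => if m = k then slot E m else 0
  have hp (k m : M) (x : E.carrier) :
      p k (slot E m x) = if m = k then slot E m x else 0 := by
    rw [← slot_proj, spreadDesc_slot E _ m (E.proj_mem _ _)]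
    split_ifs <;> rfl
  refine DirectSum.isInternal_of_projections _ p (fun k x => ?_) ?_ ?_ (fun x => ?_)
  · induction x using spread_induction with
    | h0 => rw [map_zero]; exact zero_mem _
    | h m x hx =>
      rw [hp]
      split_ifs with h
      · subst h; exact ⟨x, rfl⟩
      · exact zero_mem _
    | ha x y hx hy => rw [map_add]; exact add_mem hx hy
  · rintro m _ ⟨x, rfl⟩
    rw [hp, if_pos rfl]
  · rintro m k h _ ⟨x, rfl⟩
    rw [hp, if_neg h]
  · suffices h : ∃ s : Finset M, ∀ t, s ⊆ t → ∑ i ∈ t, p i x = x by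
      obtain ⟨s, hs⟩ := h
      exact ⟨s, hs s subset_rfl⟩
    induction x using spread_induction with
    | h0 => exact ⟨∅, by simp⟩
    | h m x hx =>
      refine ⟨{m}, fun t ht => ?_⟩
      simp only [hp]
      rw [Finset.sum_ite_eq, if_pos (ht (Finset.mem_singleton_self m))]
    | ha x y hx hy =>
      obtain ⟨s, hs⟩ := hx
      obtain ⟨s', hs'⟩ := hy
      refine ⟨s ∪ s', fun t ht => ?_⟩
      simp only [map_add, Finset.sum_add_distrib]
      rw [hs t (Finset.union_subset_left ht), hs' t (Finset.union_subset_right ht)]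

/-- The `M`-graded module with component `E_(m+L)` in degree `m`. -/
@[reducible] noncomputable def spreadObj : FGGrMod 𝒜 where
  carrier := SpreadCarrier E
  grading m := (slot E m).range
  isInternal := by convert isInternal_spread E
  smul_mem := by
    rintro a m s _ hs ⟨x, rfl⟩
    exact ⟨s • x, (smul_slot E hs m x).symm⟩
  finite := Module.Finite.equiv (spreadEquiv E).symm

theorem slot_mem (m : M) (x : E.carrier) : slot E m x ∈ (spreadObj E).grading m := ⟨x, rfl⟩

theorem mem_spreadObj {m : M} {y : SpreadCarrier E} (hy : y ∈ (spreadObj E).grading m) :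
    ∃ x ∈ E.grading (m : M ⧸ L), slot E m x = y := by
  obtain ⟨x, rfl⟩ := hy
  exact ⟨_, E.proj_mem _ x, slot_proj E m x⟩

end obj

/-- The linear map given by `g m` on the summand at `m`. -/
noncomputable def spreadLin (E : FGGrMod (coarsen 𝒜 L)) {G : Type*} [AddCommGroup G] [Module S G]
    (g : M → E.carrier →+ G)
    (h : ∀ a, ∀ s ∈ 𝒜 a, ∀ m : M, ∀ x ∈ E.grading (m : M ⧸ L), g (a + m) (s • x) = s • g m x) :
    SpreadCarrier E →ₗ[S] G :=
  linOfHomogeneous 𝒜 (spreadDesc E g) fun a s hs x => by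
    induction x using spread_induction with
    | h0 => rw [smul_zero, map_zero, smul_zero]
    | h m x hx =>
      rw [smul_slot E hs, spreadDesc_slot E g _ (E.smul_mem (mem_coarsen 𝒜 L hs) hx),
        spreadDesc_slot E g m hx, h a s hs m x hx]
    | ha x y hx hy => rw [smul_add, map_add, map_add, smul_add, hx, hy]

theorem spreadLin_slot (E : FGGrMod (coarsen 𝒜 L)) {G : Type*} [AddCommGroup G] [Module S G]
    (g : M → E.carrier →+ G)
    (h : ∀ a, ∀ s ∈ 𝒜 a, ∀ m : M, ∀ x ∈ E.grading (m : M ⧸ L), g (a + m) (s • x) = s • g m x)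
    (m : M) {x : E.carrier} (hx : x ∈ E.grading (m : M ⧸ L)) :
    spreadLin E g h (slot E m x) = g m x := spreadDesc_slot E g m hx

theorem spread_hom_ext {E : FGGrMod (coarsen 𝒜 L)} {F : FGGrMod 𝒜} {f g : spreadObj E ⟶ F}
    (h : ∀ m : M, ∀ x ∈ E.grading (m : M ⧸ L), f.toLin (slot E m x) = g.toLin (slot E m x)) :
    f = g := by
  refine map_eq_of_homogeneous fun m y hy => ?_
  obtain ⟨x, hx, rfl⟩ := mem_spreadObj E hy
  exact h m x hx

theorem coarsening_spread_hom_ext {E F : FGGrMod (coarsen 𝒜 L)}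
    {f g : (coarsening L 𝒜).obj (spreadObj E) ⟶ F}
    (h : ∀ m : M, ∀ x ∈ E.grading (m : M ⧸ L), f.toLin (slot E m x) = g.toLin (slot E m x)) :
    f = g := by
  refine coarsening_hom_ext L fun m y hy => ?_
  obtain ⟨x, hx, rfl⟩ := mem_spreadObj E hy
  exact h m x hx

/-- The morphism that applies `f` to every summand. -/
noncomputable def spreadMap {E F : FGGrMod (coarsen 𝒜 L)} (f : E ⟶ F) :
    spreadObj E ⟶ spreadObj F where
  toLin := spreadLin E (fun m => (slot F m).comp f.toLin.toAddMonoidHom) fun a s hs m x hx => by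
    change slot F (a + m) (f.toLin (s • x)) = s • slot F m (f.toLin x)
    rw [smul_slot F hs, map_smul]
  map_mem {m y} hy := by
    obtain ⟨x, hx, rfl⟩ := mem_spreadObj E hy
    rw [spreadLin_slot _ _ _ _ hx]
    exact slot_mem F m _

theorem spreadMap_slot {E F : FGGrMod (coarsen 𝒜 L)} (f : E ⟶ F) {m : M} {x : E.carrier}
    (hx : x ∈ E.grading (m : M ⧸ L)) :
    (spreadMap f).toLin (slot E m x) = slot F m (f.toLin x) :=
  spreadDesc_slot _ _ _ hx

/-- The functor `E ↦ ⨁ m, E_(m+L)` from `M ⧸ L`-graded to `M`-graded modules. -/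
@[reducible] noncomputable def spread (𝒜 : M → AddSubgroup S) [GradedRing 𝒜]
    (L : AddSubgroup M) [Finite L] : FGGrMod (coarsen 𝒜 L) ⥤ FGGrMod 𝒜 where
  obj E := spreadObj E
  map f := spreadMap f
  map_id E := spread_hom_ext fun m x hx => spreadMap_slot _ hx
  map_comp {E F G} f g := spread_hom_ext fun m x hx => by
    change _ = (spreadMap g).toLin ((spreadMap f).toLin (slot E m x))
    rw [spreadMap_slot _ hx, spreadMap_slot f hx, spreadMap_slot g (f.map_mem hx)]
    rfl

theorem spread_map_slot {E F : FGGrMod (coarsen 𝒜 L)} (f : E ⟶ F) {m : M} {x : E.carrier}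
    (hx : x ∈ E.grading (m : M ⧸ L)) :
    Hom.toLin ((spread 𝒜 L).map f) (slot E m x) = slot F m (f.toLin x) :=
  spreadMap_slot f hx

instance : (spread 𝒜 L).Additive where
  map_add {_ _ f g} := spread_hom_ext fun m x hx => by
    rw [spread_map_slot _ hx, add_toLin, LinearMap.add_apply, add_toLin, LinearMap.add_apply,
      spread_map_slot f hx, spread_map_slot g hx, map_add]

section units

/-- `E → ⨁ m, ⨁ l, E_(m+l)` sends an element of degree `m` to itself in the summand at `m`. -/
noncomputable def toSpread (E : FGGrMod 𝒜) : E ⟶ (spread 𝒜 L).obj ((coarsening L 𝒜).obj E) where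
  toLin := linOfHomogeneous 𝒜 (E.desc fun m => slot ((coarsening L 𝒜).obj E) m)
    fun a s hs => E.desc_smul _ fun m x hx => by
      rw [E.desc_of_mem _ (E.smul_mem hs hx), smul_slot _ hs]
  map_mem {m x} hx := by
    rw [linOfHomogeneous_apply, E.desc_of_mem _ hx]
    exact slot_mem _ m _

theorem toSpread_of_mem (E : FGGrMod 𝒜) {m : M} {x : E.carrier} (hx : x ∈ E.grading m) :
    (toSpread (L := L) E).toLin x = slot ((coarsening L 𝒜).obj E) m x :=
  E.desc_of_mem _ hx

/-- `⨁ m, ⨁ l, E_(m+l) → E` is, on the summand at `m`, the projection to `E_m`. -/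
noncomputable def ofSpread (E : FGGrMod 𝒜) : (spread 𝒜 L).obj ((coarsening L 𝒜).obj E) ⟶ E where
  toLin := spreadLin ((coarsening L 𝒜).obj E) (fun m => E.proj m) fun a s hs m x _ =>
    E.proj_smul hs m x
  map_mem {m y} hy := by
    obtain ⟨x, hx, rfl⟩ := mem_spreadObj _ hy
    rw [spreadLin_slot _ _ _ _ hx]
    exact E.proj_mem m _

theorem ofSpread_slot (E : FGGrMod 𝒜) {m : M} {x : E.carrier}
    (hx : x ∈ (E.coarsenObj L).grading (m : M ⧸ L)) :
    (ofSpread (L := L) E).toLin (slot ((coarsening L 𝒜).obj E) m x) = E.proj m x :=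
  spreadDesc_slot _ _ _ hx

/-- The sum of all the summands `⨁ m, E_(m+L) → E`. -/
noncomputable def spreadSum (E : FGGrMod (coarsen 𝒜 L)) :
    (coarsening L 𝒜).obj ((spread 𝒜 L).obj E) ⟶ E :=
  coarsenHomMk L (E := spreadObj E)
    (spreadLin E (fun _ => AddMonoidHom.id _) fun _ _ _ _ _ _ => rfl) fun m y hy => by
      obtain ⟨x, hx, rfl⟩ := mem_spreadObj _ hy
      rw [spreadLin_slot _ _ _ _ hx]
      exact hx

theorem spreadSum_slot (E : FGGrMod (coarsen 𝒜 L)) {m : M} {x : E.carrier}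
    (hx : x ∈ E.grading (m : M ⧸ L)) : (spreadSum E).toLin (slot E m x) = x :=
  spreadDesc_slot _ _ _ hx

/-- `E → ⨁ m, E_(m+L)` sends an element of degree `q` to the sum of its copies in the summands
at all `m` in the coset `q`. -/
noncomputable def diagSpread (E : FGGrMod (coarsen 𝒜 L)) :
    E ⟶ (coarsening L 𝒜).obj ((spread 𝒜 L).obj E) where
  toLin := linOfHomogeneous 𝒜 (E.desc fun q => ∑ m ∈ fiber L q, slot E m) fun a s hs =>
      E.desc_smul _ fun q x hx => by
    rw [E.desc_of_mem _ (E.smul_mem (mem_coarsen 𝒜 L hs) hx),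
      fiber_add, Finset.sum_map, AddMonoidHom.finsetSum_apply, AddMonoidHom.finsetSum_apply,
      Finset.smul_sum]
    exact Finset.sum_congr rfl fun m _ => (smul_slot E hs m x).symm
  map_mem {q x} hx := by
    rw [linOfHomogeneous_apply, E.desc_of_mem _ hx, AddMonoidHom.finsetSum_apply]
    refine sum_mem fun m hm => ?_
    rw [← mem_fiber.1 hm]
    exact (spreadObj E).mem_coarsenObj L (slot_mem E m x)

theorem diagSpread_of_mem (E : FGGrMod (coarsen 𝒜 L)) {q : M ⧸ L} {x : E.carrier}
    (hx : x ∈ E.grading q) : (diagSpread E).toLin x = ∑ m ∈ fiber L q, slot E m x :=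
  (E.desc_of_mem _ hx).trans (AddMonoidHom.finsetSum_apply _ _ _)

end units

section adjunctions
variable (𝒜 L)

/-- Coarsening is left adjoint to spreading. -/
noncomputable def coarseningAdjSpread : coarsening L 𝒜 ⊣ spread 𝒜 L where
  unit :=
    { app E := toSpread E
      naturality {E F} f := map_eq_of_homogeneous (E := E) fun m x hx => by
        change (toSpread F).toLin (f.toLin x) =
          Hom.toLin ((spread 𝒜 L).map ((coarsening L 𝒜).map f)) ((toSpread E).toLin x)
        rw [toSpread_of_mem _ hx, toSpread_of_mem _ (f.map_mem hx),
          spread_map_slot _ (E.mem_coarsenObj L hx)] }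
  counit :=
    { app E := spreadSum E
      naturality {E F} f := coarsening_spread_hom_ext fun m x hx => by
        change (spreadSum F).toLin (Hom.toLin ((spread 𝒜 L).map f) (slot E m x)) =
          f.toLin ((spreadSum E).toLin (slot E m x))
        rw [spreadSum_slot E hx, spread_map_slot f hx, spreadSum_slot F (f.map_mem hx)] }
  left_triangle_components E := coarsening_hom_ext L fun m x hx => by
    change (spreadSum ((coarsening L 𝒜).obj E)).toLin ((toSpread (L := L) E).toLin x) = x
    rw [toSpread_of_mem _ hx, spreadSum_slot _ (E.mem_coarsenObj L hx)]
  right_triangle_components E := spread_hom_ext fun m x hx => by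
    change Hom.toLin ((spread 𝒜 L).map (spreadSum E))
      ((toSpread (L := L) (spreadObj E)).toLin (slot E m x)) = slot E m x
    rw [toSpread_of_mem _ (slot_mem E m x),
      spread_map_slot _ ((spreadObj E).mem_coarsenObj L (slot_mem E m x)), spreadSum_slot E hx]

/-- Spreading is left adjoint to coarsening. -/
noncomputable def spreadAdjCoarsening : spread 𝒜 L ⊣ coarsening L 𝒜 where
  unit :=
    { app E := diagSpread E
      naturality {E F} f := map_eq_of_homogeneous (E := E) fun q x hx => by
        change (diagSpread F).toLin (f.toLin x) =
          Hom.toLin ((spread 𝒜 L).map f) ((diagSpread E).toLin x)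
        rw [diagSpread_of_mem _ hx, diagSpread_of_mem _ (f.map_mem hx)]
        refine Eq.trans ?_ (map_sum (Hom.toLin ((spread 𝒜 L).map f)) _ _).symm
        exact Finset.sum_congr rfl fun m hm =>
          (spread_map_slot f (by rwa [mem_fiber.1 hm])).symm }
  counit :=
    { app E := ofSpread E
      naturality {E F} f := spread_hom_ext fun m x hx => by
        change (ofSpread F).toLin (Hom.toLin ((spread 𝒜 L).map ((coarsening L 𝒜).map f))
          (slot _ m x)) = f.toLin ((ofSpread E).toLin (slot _ m x))
        rw [spread_map_slot _ hx, ofSpread_slot _ hx,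
          ofSpread_slot _ (((coarsening L 𝒜).map f).map_mem hx)]
        exact (f.map_proj m x).symm }
  left_triangle_components E := spread_hom_ext fun m x hx => by
    change (ofSpread (L := L) (spreadObj E)).toLin
      (Hom.toLin ((spread 𝒜 L).map (diagSpread E)) (slot E m x)) = slot E m x
    rw [spread_map_slot _ hx, ofSpread_slot _ ((diagSpread E).map_mem hx),
      diagSpread_of_mem _ hx]
    refine (map_sum ((spreadObj E).proj m) _ _).trans ?_
    rw [Finset.sum_eq_single m]
    · exact (spreadObj E).proj_same (slot_mem E m x)
    · exact fun k _ hk => (spreadObj E).proj_ne hk (slot_mem E k x)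
    · exact fun h => (h (mem_fiber.2 rfl)).elim
  right_triangle_components E := coarsening_hom_ext L fun m x hx => by
    change (ofSpread (L := L) E).toLin ((diagSpread ((coarsening L 𝒜).obj E)).toLin x) = x
    have hx' := E.mem_coarsenObj L hx
    rw [diagSpread_of_mem _ hx']
    refine (map_sum (ofSpread (L := L) E).toLin _ _).trans ?_
    rw [Finset.sum_eq_single m]
    · rw [ofSpread_slot _ hx', E.proj_same hx]
    · intro k hk hkm
      rw [ofSpread_slot _ (by rwa [mem_fiber.1 hk]), E.proj_ne hkm.symm hx]
    · exact fun h => (h (mem_fiber.2 rfl)).elim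

/-- Every coset of `L` has as many elements as `L`. -/
theorem diagSpread_comp_spreadSum (E : FGGrMod (coarsen 𝒜 L)) :
    diagSpread E ≫ spreadSum E = Nat.card L • 𝟙 E := by
  refine map_eq_of_homogeneous fun q x hx => ?_
  change (spreadSum E).toLin ((diagSpread E).toLin x) = Nat.card L • x
  rw [diagSpread_of_mem _ hx, ← card_fiber q, ← Finset.sum_const]
  refine (map_sum (spreadSum E).toLin _ _).trans ?_
  exact Finset.sum_congr rfl fun m hm => spreadSum_slot E (by rwa [mem_fiber.1 hm])

/-- Summing all copies in `⨁ m, ⨁ l, E_(m+l)` is the sum over `l` of the projections to `E(l)`,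
since an element of `⨁ l, E_(m+l)` is the sum of its components. -/
theorem sum_coarsening_ofSpread [Fintype L] (E : FGGrMod 𝒜) :
    ∑ l : L, (coarsening L 𝒜).map ((spread 𝒜 L).map ((coarseningTwist L l).inv.app E)) ≫
      (coarsening L 𝒜).map (ofSpread ((twist (l : M)).obj E)) ≫ (coarseningTwist L l).hom.app E =
    spreadSum ((coarsening L 𝒜).obj E) := by
  refine coarsening_spread_hom_ext fun m x hx => ?_
  rw [spreadSum_slot _ hx, sum_toLin]
  refine Eq.trans (Finset.sum_congr rfl fun l _ => ?_) (E.sum_proj_of_mem_coarsenObj hx)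
  change (ofSpread ((twist (l : M)).obj E)).toLin
    (Hom.toLin ((spread 𝒜 L).map ((coarseningTwist L l).inv.app E)) (slot _ m x)) = _
  rw [spread_map_slot _ hx]
  exact (ofSpread_slot _ (((coarseningTwist L l).inv.app E).map_mem hx)).trans
    (proj_twist _ _ _ _)

theorem toSpread_comp_ofSpread (E : FGGrMod 𝒜) :
    toSpread (L := L) E ≫ ofSpread E = 𝟙 E := by
  refine map_eq_of_homogeneous fun m x hx => ?_
  change (ofSpread E).toLin ((toSpread (L := L) E).toLin x) = x
  rw [toSpread_of_mem _ hx, ofSpread_slot _ (E.mem_coarsenObj L hx), E.proj_same hx]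

/-- The embedding of `E(l')` and the projection to `E(l)` pick different components when
`l ≠ l'`. -/
theorem toSpread_comp_ofSpread_twist (E : FGGrMod 𝒜) {l l' : L} (h : l ≠ l') :
    toSpread (L := L) ((twist (l' : M)).obj E) ≫
      (spread 𝒜 L).map ((coarseningTwist L l').hom.app E) ≫
      (spread 𝒜 L).map ((coarseningTwist L l).inv.app E) ≫
      ofSpread ((twist (l : M)).obj E) = 0 := by
  refine map_eq_of_homogeneous fun m x hx => ?_
  have hx' := ((twist (l' : M)).obj E).mem_coarsenObj L hx
  have h₁ := ((coarseningTwist L l').hom.app E).map_mem hx'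
  have h₂ := ((coarseningTwist L l).inv.app E).map_mem h₁
  change (ofSpread ((twist (l : M)).obj E)).toLin
    (Hom.toLin ((spread 𝒜 L).map ((coarseningTwist L l).inv.app E))
      (Hom.toLin ((spread 𝒜 L).map ((coarseningTwist L l').hom.app E))
        ((toSpread ((twist (l' : M)).obj E)).toLin x))) = 0
  rw [toSpread_of_mem _ hx, spread_map_slot _ hx', spread_map_slot _ h₁]
  exact ((ofSpread_slot _ h₂).trans (proj_twist _ _ _ _)).trans
    (E.proj_ne (fun e => h (Subtype.ext (add_left_cancel e).symm)) hx)

end adjunctions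

section exactness

instance : PreservesFiniteLimits (coarsening L 𝒜) where
  preservesFiniteLimits _ _ _ :=
    (spreadAdjCoarsening 𝒜 L).rightAdjoint_preservesLimits.preservesLimitsOfShape

instance : PreservesFiniteColimits (coarsening L 𝒜) where
  preservesFiniteColimits _ _ _ :=
    (coarseningAdjSpread 𝒜 L).leftAdjoint_preservesColimits.preservesColimitsOfShape

instance : PreservesFiniteLimits (spread 𝒜 L) where
  preservesFiniteLimits _ _ _ :=
    (coarseningAdjSpread 𝒜 L).rightAdjoint_preservesLimits.preservesLimitsOfShape

instance : PreservesFiniteColimits (spread 𝒜 L) where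
  preservesFiniteColimits _ _ _ :=
    (spreadAdjCoarsening 𝒜 L).leftAdjoint_preservesColimits.preservesColimitsOfShape

instance : (coarsening L 𝒜).PreservesProjectiveObjects :=
  Functor.preservesProjectiveObjects_of_adjunction_of_preservesEpimorphisms
    (coarseningAdjSpread 𝒜 L)

instance : (spread 𝒜 L).PreservesProjectiveObjects :=
  Functor.preservesProjectiveObjects_of_adjunction_of_preservesEpimorphisms
    (spreadAdjCoarsening 𝒜 L)

end exactness

end spread
end FGGrMod

/-! ### Exact functors on singularity categories -/

namespace CategoryTheory

section whiskering
universe w₁ w₂ w₃ w₄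
variable {X : Type*} [Category* X] {A : Type*} [Category* A]

/-- Every natural transformation `Q ⋙ F ⟶ Q ⋙ G` extends along the essentially surjective
functor `Q` to a unique one `F ⟶ G`, whatever the target category in the given universes. The field
`natural` states that the components of such a transformation are natural for all morphisms between
objects of the image of `Q`, not only for those in the image of `Q`. -/
class LiftsNatTrans (Q : X ⥤ A) : Prop where
  essSurj : Q.EssSurj
  natural {E : Type w₁} [Category.{w₂} E] {F G : A ⥤ E} (τ : Q ⋙ F ⟶ Q ⋙ G) {K K' : X}
    (f : Q.obj K ⟶ Q.obj K') : F.map f ≫ τ.app K' = τ.app K ≫ G.map f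

attribute [instance] LiftsNatTrans.essSurj

variable (Q : X ⥤ A) [LiftsNatTrans.{w₁, w₂} Q] {E : Type w₁} [Category.{w₂} E] {F G : A ⥤ E}

/-- The natural transformation extending a natural transformation `Q ⋙ F ⟶ Q ⋙ G`. -/
noncomputable def extendNatTrans (τ : Q ⋙ F ⟶ Q ⋙ G) : F ⟶ G where
  app a := F.map (Q.objObjPreimageIso a).inv ≫ τ.app (Q.objPreimage a) ≫
    G.map (Q.objObjPreimageIso a).hom
  naturality a b f := by
    have h := LiftsNatTrans.natural τ
      ((Q.objObjPreimageIso a).hom ≫ f ≫ (Q.objObjPreimageIso b).inv)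
    have h' := F.map (Q.objObjPreimageIso a).inv ≫= h =≫ G.map (Q.objObjPreimageIso b).hom
    simpa [← Functor.map_comp_assoc, ← Functor.map_comp] using h'

@[simp]
theorem extendNatTrans_app_obj (τ : Q ⋙ F ⟶ Q ⋙ G) (K : X) :
    (extendNatTrans Q τ).app (Q.obj K) = τ.app K := by
  have h := LiftsNatTrans.natural τ (Q.objObjPreimageIso (Q.obj K)).hom
  dsimp [extendNatTrans]
  rw [← h, ← Functor.map_comp_assoc, Iso.inv_hom_id, Functor.map_id, Category.id_comp]

theorem natTrans_ext_of_essSurj (Q : X ⥤ A) {E : Type*} [Category* E] {F G : A ⥤ E}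
    [Q.EssSurj] {τ σ : F ⟶ G} (h : ∀ K, τ.app (Q.obj K) = σ.app (Q.obj K)) : τ = σ := by
  ext a
  rw [← cancel_epi (F.map (Q.objObjPreimageIso a).hom), τ.naturality, σ.naturality, h]

/-- The natural isomorphism extending a natural isomorphism `Q ⋙ F ≅ Q ⋙ G`. -/
noncomputable def extendNatIso (e : Q ⋙ F ≅ Q ⋙ G) : F ≅ G where
  hom := extendNatTrans Q e.hom
  inv := extendNatTrans Q e.inv
  hom_inv_id := natTrans_ext_of_essSurj Q fun K => by
    rw [NatTrans.comp_app, extendNatTrans_app_obj, extendNatTrans_app_obj]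
    exact e.hom_inv_id_app K
  inv_hom_id := natTrans_ext_of_essSurj Q fun K => by
    rw [NatTrans.comp_app, extendNatTrans_app_obj, extendNatTrans_app_obj]
    exact e.inv_hom_id_app K

@[simp]
theorem extendNatIso_hom_app_obj (e : Q ⋙ F ≅ Q ⋙ G) (K : X) :
    (extendNatIso Q e).hom.app (Q.obj K) = e.hom.app K := extendNatTrans_app_obj Q _ K

@[simp]
theorem extendNatIso_inv_app_obj (e : Q ⋙ F ≅ Q ⋙ G) (K : X) :
    (extendNatIso Q e).inv.app (Q.obj K) = e.inv.app K := extendNatTrans_app_obj Q _ K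

theorem liftsNatTrans_of_isLocalization (W : MorphismProperty X) (Q : X ⥤ A) [Q.IsLocalization W] :
    LiftsNatTrans.{w₁, w₂} Q where
  essSurj := Localization.essSurj Q W
  natural {E _ F G} τ K K' f := by
    have := Localization.full_whiskeringLeft Q W E
    obtain ⟨σ, rfl⟩ := ((Functor.whiskeringLeft X A E).obj Q).map_surjective τ
    exact σ.naturality f

instance (W : MorphismProperty X) : LiftsNatTrans.{w₁, w₂} W.Q :=
  liftsNatTrans_of_isLocalization W W.Q

instance {B : Type*} [Category* B] (Q : X ⥤ A) (R : A ⥤ B) [LiftsNatTrans.{w₁, w₂} Q]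
    [LiftsNatTrans.{w₁, w₂} R] : LiftsNatTrans.{w₁, w₂} (Q ⋙ R) where
  essSurj := inferInstance
  natural {E _ F G} τ K K' f := by
    have h := LiftsNatTrans.natural (Q := R) (F := F) (G := G)
      (extendNatTrans Q (F := R ⋙ F) (G := R ⋙ G) τ) f
    rwa [extendNatTrans_app_obj, extendNatTrans_app_obj] at h

end whiskering
end CategoryTheory

namespace DerivedCategory
open CategoryTheory Pretriangulated
universe w w₁ w₂ u₁ u₂ v₁ v₂
variable (C : Type u₁) [Category.{v₁} C] [Abelian C] [HasDerivedCategory.{w₁} C]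

/-- The complexes with bounded cohomology. -/
def cohBounded : ObjectProperty (CochainComplex C ℤ) :=
  (TStructure.t (C := C)).bounded.inverseImage Q

/-- The category of complexes with bounded cohomology. -/
abbrev CohBounded := (cohBounded C).FullSubcategory

/-- The bounded derived category as a quotient of the category of complexes with bounded
cohomology. -/
noncomputable def boundedQ : CohBounded C ⥤ Bounded C :=
  (TStructure.t (C := C)).bounded.lift ((cohBounded C).ι ⋙ Q) fun K => K.2

instance : (boundedQ C).EssSurj where
  mem_essImage X := by
    have e := Q.objObjPreimageIso X.obj
    exact ⟨⟨Q.objPreimage X.obj, (TStructure.t (C := C)).bounded.prop_of_iso e.symm X.2⟩,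
      ⟨(TStructure.t (C := C)).bounded.isoMk e⟩⟩

/-- A morphism between the images of two complexes `K`, `K'` in the derived category is a fraction
`s⁻¹ g` with a quasi-isomorphism `s : Z ⟶ K`. If `K` has bounded cohomology, then so does `Z`, and
naturality for the fraction follows from naturality for `s` and `g`. -/
instance : LiftsNatTrans.{w, w₂} (boundedQ C) where
  essSurj := inferInstance
  natural {E _ F G} τ K K' f := by
    obtain ⟨Z, s, hs, g, h⟩ := right_fac ((Bounded.ι (C := C)).map f)
    let Z' : CohBounded C :=
      ⟨Z, (TStructure.t (C := C)).bounded.prop_of_iso (asIso (Q.map s)).symm K.2⟩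
    let s' : Z' ⟶ K := ObjectProperty.homMk s
    let g' : Z' ⟶ K' := ObjectProperty.homMk g
    have hs' : IsIso ((boundedQ C).map s') := by
      have : IsIso ((Bounded.ι (C := C)).map ((boundedQ C).map s')) := hs
      exact isIso_of_fully_faithful (Bounded.ι (C := C)) _
    have hf : (boundedQ C).map s' ≫ f = (boundedQ C).map g' := by
      apply (Bounded.ι (C := C)).map_injective
      rw [Functor.map_comp, h]
      exact IsIso.hom_inv_id_assoc (Q.map s) (Q.map g)
    have h₁ := τ.naturality s'
    have h₂ := τ.naturality g'
    dsimp only [Functor.comp_map] at h₁ h₂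
    rw [← cancel_epi (F.map ((boundedQ C).map s')), reassoc_of% h₁, ← Functor.map_comp_assoc,
      hf, h₂, ← hf, Functor.map_comp]

/-- The Verdier quotient of the bounded derived category by the perfect objects. -/
abbrev Singularity := ((perfect C).inverseImage (Bounded.ι (C := C))).trW.Localization

/-- The singularity category as a quotient of the category of complexes with bounded
cohomology. -/
noncomputable def singularityQ : CohBounded C ⥤ Singularity C :=
  boundedQ C ⋙ ((perfect C).inverseImage (Bounded.ι (C := C))).trW.Q

instance : LiftsNatTrans.{w, w₂} (singularityQ C) :=
  inferInstanceAs (LiftsNatTrans.{w, w₂} (boundedQ C ⋙ _))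

variable {C} {D : Type u₂} [Category.{v₂} D] [Abelian D] [HasDerivedCategory.{w₂} D]
  (F : C ⥤ D) [F.Additive] [PreservesFiniteLimits F] [PreservesFiniteColimits F]

theorem bounded_mapDerivedCategory (X : DerivedCategory C)
    (hX : (TStructure.t (C := C)).bounded X) :
    (TStructure.t (C := D)).bounded (F.mapDerivedCategory.obj X) := by
  obtain ⟨⟨a, ⟨K, e, h⟩⟩, ⟨b, ⟨K', e', h'⟩⟩⟩ := hX
  refine ⟨⟨a, ⟨⟨(F.mapHomologicalComplex _).obj K, ?_, ?_⟩⟩⟩,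
    ⟨b, ⟨⟨(F.mapHomologicalComplex _).obj K', ?_, ?_⟩⟩⟩⟩
  · exact F.mapDerivedCategory.mapIso e ≪≫ F.mapDerivedCategoryFactors.app K
  · rw [CochainComplex.isStrictlyGE_iff] at h ⊢
    exact fun i hi => F.map_isZero (h i hi)
  · exact F.mapDerivedCategory.mapIso e' ≪≫ F.mapDerivedCategoryFactors.app K'
  · rw [CochainComplex.isStrictlyLE_iff] at h' ⊢
    exact fun i hi => F.map_isZero (h' i hi)

theorem perfect_mapDerivedCategory [F.PreservesProjectiveObjects] (X : DerivedCategory C)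
    (hX : perfect C X) : perfect D (F.mapDerivedCategory.obj X) := by
  obtain ⟨K, ⟨a, ha⟩, ⟨b, hb⟩, h₃, ⟨e⟩⟩ := hX
  refine ⟨(F.mapHomologicalComplex _).obj K, ⟨a, ?_⟩, ⟨b, ?_⟩, fun i => ?_,
    ⟨F.mapDerivedCategory.mapIso e ≪≫ F.mapDerivedCategoryFactors.app K⟩⟩
  · rw [CochainComplex.isStrictlyGE_iff] at ha ⊢
    exact fun i hi => F.map_isZero (ha i hi)
  · rw [CochainComplex.isStrictlyLE_iff] at hb ⊢
    exact fun i hi => F.map_isZero (hb i hi)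
  · exact F.projective_obj_of_projective (h₃ i)

/-- The functor on complexes with bounded cohomology induced by an exact functor. -/
noncomputable def mapCohBounded : CohBounded C ⥤ CohBounded D :=
  (cohBounded D).lift ((cohBounded C).ι ⋙ F.mapHomologicalComplex _) fun K =>
    (TStructure.t (C := D)).bounded.prop_of_iso (F.mapDerivedCategoryFactors.app K.obj)
      (bounded_mapDerivedCategory F _ K.2)

/-- The functor on bounded derived categories induced by an exact functor. -/
noncomputable def mapBounded : Bounded C ⥤ Bounded D :=
  (TStructure.t (C := D)).bounded.lift (Bounded.ι (C := C) ⋙ F.mapDerivedCategory) fun X =>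
    bounded_mapDerivedCategory F _ X.2

noncomputable instance : (mapBounded F).CommShift ℤ :=
  inferInstanceAs (((TStructure.t (C := D)).bounded.lift _ _).CommShift ℤ)

instance : (mapBounded F).IsTriangulated :=
  inferInstanceAs (((TStructure.t (C := D)).bounded.lift _ _).IsTriangulated)

/-- `mapBounded F` is induced by the termwise application of `F` to complexes. -/
noncomputable def mapBoundedFactors :
    boundedQ C ⋙ mapBounded F ≅ mapCohBounded F ⋙ boundedQ D :=
  NatIso.ofComponents (fun K => (TStructure.t (C := D)).bounded.isoMk
    (F.mapDerivedCategoryFactors.app K.obj)) fun {K K'} f => by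
      apply (Bounded.ι (C := D)).map_injective
      exact F.mapDerivedCategoryFactors.hom.naturality f.hom

variable [F.PreservesProjectiveObjects]

/-- The cone of the image of a morphism with perfect cone is perfect. -/
theorem trW_mapBounded : ((perfect C).inverseImage (Bounded.ι (C := C))).trW.IsInvertedBy
    (mapBounded F ⋙ ((perfect D).inverseImage (Bounded.ι (C := D))).trW.Q) := by
  intro X Y f hf
  apply Localization.inverts ((perfect D).inverseImage (Bounded.ι (C := D))).trW.Q
    ((perfect D).inverseImage (Bounded.ι (C := D))).trW
  obtain ⟨Z, g, h, hT, hZ⟩ := hf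
  exact ⟨_, _, _, (mapBounded F).map_distinguished _ hT, perfect_mapDerivedCategory F _ hZ⟩

/-- The functor on singularity categories induced by an exact functor that preserves projective
objects. -/
noncomputable def mapSingularity : Singularity C ⥤ Singularity D :=
  Localization.lift (mapBounded F ⋙ ((perfect D).inverseImage (Bounded.ι (C := D))).trW.Q)
    (trW_mapBounded F) ((perfect C).inverseImage (Bounded.ι (C := C))).trW.Q

/-- `mapSingularity F` is induced by `mapBounded F`. -/
noncomputable def mapSingularityFac :
    ((perfect C).inverseImage (Bounded.ι (C := C))).trW.Q ⋙ mapSingularity F ≅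
      mapBounded F ⋙ ((perfect D).inverseImage (Bounded.ι (C := D))).trW.Q :=
  Localization.fac _ (trW_mapBounded F) _

instance : (mapSingularity F).Additive := by
  rw [Localization.functor_additive_iff ((perfect C).inverseImage (Bounded.ι (C := C))).trW.Q
    ((perfect C).inverseImage (Bounded.ι (C := C))).trW]
  exact Functor.additive_of_iso (mapSingularityFac F).symm

/-- `mapSingularity F` is induced by the termwise application of `F` to complexes. -/
noncomputable def mapSingularityFactors :
    singularityQ C ⋙ mapSingularity F ≅ mapCohBounded F ⋙ singularityQ D :=
  Functor.associator _ _ _ ≪≫ Functor.isoWhiskerLeft (boundedQ C) (mapSingularityFac F) ≪≫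
    (Functor.associator _ _ _).symm ≪≫
    Functor.isoWhiskerRight (mapBoundedFactors F) _ ≪≫ Functor.associator _ _ _

end DerivedCategory

/-! ### A criterion for covers -/

namespace CategoryTheory
open scoped DirectSum

/-- The data on functors `Φ : T ⥤ S` and `Ψ : S ⥤ T`, for an action of a finite group `Γ` on `T`,
that make `T` a cover of `S`. Informally, `Ψ (Φ X)` is the sum of all `X⟦g⟧`, with inclusion `unit`
and projection `proj` of the summand `X`; the summand `X⟦g⟧` is reached through the isomorphism
`inv g`, which is compatible with the group structure by `inv_zero` and `inv_add`. The
transformations `unit` and `sum` satisfy one of the triangle identities of an adjunction between `Φ`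
and `Ψ`, and `sum` is the sum of the projections by `sum_proj`. Finally, `Y` is a direct summand of
`Φ (Ψ Y)` by `isIso_diag_sum`. -/
structure CoverData {T S : Type*} [Category* T] [Category* S] [Preadditive T] [Preadditive S]
    (Γ : Type*) [AddCommGroup Γ] [Fintype Γ] [HasShift T Γ] (Φ : T ⥤ S) (Ψ : S ⥤ T) where
  unit : 𝟭 T ⟶ Φ ⋙ Ψ
  proj : Φ ⋙ Ψ ⟶ 𝟭 T
  diag : 𝟭 S ⟶ Ψ ⋙ Φ
  sum : Ψ ⋙ Φ ⟶ 𝟭 S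
  inv (g : Γ) : shiftFunctor T g ⋙ Φ ≅ Φ
  inv_zero (X : T) : (inv 0).hom.app X = Φ.map ((shiftFunctorZero T Γ).hom.app X)
  inv_add (a b : Γ) (X : T) : (inv (a + b)).hom.app X =
    Φ.map ((shiftFunctorAdd T a b).hom.app X) ≫ (inv b).hom.app (X⟦a⟧) ≫ (inv a).hom.app X
  unit_sum (X : T) : Φ.map (unit.app X) ≫ sum.app (Φ.obj X) = 𝟙 _
  sum_proj (X : T) : ∑ g : Γ, Φ.map (Ψ.map ((inv g).inv.app X)) ≫ Φ.map (proj.app (X⟦g⟧)) ≫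
    (inv g).hom.app X = sum.app (Φ.obj X)
  unit_proj (X : T) : unit.app X ≫ proj.app X = 𝟙 X
  unit_proj_ne (g g' : Γ) (h : g ≠ g') (X : T) : unit.app (X⟦g'⟧) ≫ Ψ.map ((inv g').hom.app X) ≫
    Ψ.map ((inv g).inv.app X) ≫ proj.app (X⟦g⟧) = 0
  isIso_diag_sum (Y : S) : IsIso (diag.app Y ≫ sum.app Y)

namespace CoverData

section cover
variable {T S : Type*} [Category* T] [Category* S] [Preadditive T] [Preadditive S]
  {Γ : Type*} [AddCommGroup Γ] [Fintype Γ] [HasShift T Γ]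
  {Φ : T ⥤ S} {Ψ : S ⥤ T} (d : CoverData Γ Φ Ψ)

/-- The assignment `f ↦ Φ f ≫ inv` takes the composition of shifted morphisms to composition. -/
theorem map_comp_inv {A B C : T} {a b : Γ} (f : ShiftedHom A B a) (k : ShiftedHom B C b) :
    Φ.map (f.comp k (rfl : b + a = b + a)) ≫ (d.inv (b + a)).hom.app C =
      (Φ.map f ≫ (d.inv a).hom.app B) ≫ Φ.map k ≫ (d.inv b).hom.app C := by
  have h := (d.inv a).hom.naturality k
  dsimp at h
  have h' : Φ.map ((shiftFunctorAdd T b a).inv.app C) ≫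
      Φ.map ((shiftFunctorAdd T b a).hom.app C) = 𝟙 _ := by
    rw [← Functor.map_comp, Iso.inv_hom_id_app, Functor.map_id]
  rw [ShiftedHom.comp, d.inv_add, shiftFunctorAdd'_eq_shiftFunctorAdd]
  simp only [Functor.map_comp, Category.assoc, reassoc_of% h', reassoc_of% h]

section component
variable [Ψ.Additive]

/-- The component at `g` of the family of morphisms `A ⟶ B⟦g⟧` corresponding to `Φ A ⟶ Φ B`. -/
noncomputable def component {A B : T} (g : Γ) : (Φ.obj A ⟶ Φ.obj B) →+ (A ⟶ B⟦g⟧) :=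
  AddMonoidHom.mk' (fun k => d.unit.app A ≫ Ψ.map k ≫ Ψ.map ((d.inv g).inv.app B) ≫
    d.proj.app (B⟦g⟧)) fun k k' => by simp

theorem component_map {A B : T} {g g' : Γ} (f : ShiftedHom A B g') :
    d.component g (Φ.map f ≫ (d.inv g').hom.app B) =
      f ≫ d.unit.app (B⟦g'⟧) ≫ Ψ.map ((d.inv g').hom.app B) ≫ Ψ.map ((d.inv g).inv.app B) ≫
        d.proj.app (B⟦g⟧) := by
  have h := d.unit.naturality f
  dsimp at h
  change d.unit.app A ≫ Ψ.map (Φ.map f ≫ (d.inv g').hom.app B) ≫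
    Ψ.map ((d.inv g).inv.app B) ≫ d.proj.app (B⟦g⟧) = _
  rw [Functor.map_comp, Category.assoc, reassoc_of% h]

theorem component_map_self {A B : T} {g : Γ} (f : ShiftedHom A B g) :
    d.component g (Φ.map f ≫ (d.inv g).hom.app B) = f := by
  rw [component_map, ← Functor.map_comp_assoc, Iso.hom_inv_id_app]
  dsimp
  rw [Functor.map_id, Category.id_comp]
  erw [d.unit_proj]
  exact Category.comp_id f

theorem component_map_ne {A B : T} {g g' : Γ} (h : g ≠ g') (f : ShiftedHom A B g') :
    d.component g (Φ.map f ≫ (d.inv g').hom.app B) = 0 := by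
  rw [component_map, d.unit_proj_ne g g' h, comp_zero]

theorem sum_component {A B : T} (k : Φ.obj A ⟶ Φ.obj B) :
    ∑ g : Γ, Φ.map (d.component g k) ≫ (d.inv g).hom.app B = k := by
  have h := d.sum.naturality k
  dsimp at h
  have h' (g : Γ) : Φ.map (d.component g k) ≫ (d.inv g).hom.app B =
      (Φ.map (d.unit.app A) ≫ Φ.map (Ψ.map k)) ≫ Φ.map (Ψ.map ((d.inv g).inv.app B)) ≫
        Φ.map (d.proj.app (B⟦g⟧)) ≫ (d.inv g).hom.app B := by
    simp [component]
  simp only [h']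
  rw [← Preadditive.comp_sum, d.sum_proj, Category.assoc, h, reassoc_of% d.unit_sum A]

end component

variable [Φ.Additive]

open Classical in
/-- A family of morphisms `A ⟶ B⟦g⟧` is sent to the sum of the induced morphisms `Φ A ⟶ Φ B`. -/
noncomputable def mapOrbit (A B : T) : (⨁ g : Γ, ShiftedHom A B g) →+ (Φ.obj A ⟶ Φ.obj B) :=
  DirectSum.toAddMonoid fun g => AddMonoidHom.mk' (fun f => Φ.map f ≫ (d.inv g).hom.app B)
    (fun f f' => by rw [Functor.map_add, Preadditive.add_comp])

open Classical in
theorem mapOrbit_of {A B : T} {g : Γ} (f : ShiftedHom A B g) :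
    d.mapOrbit A B (DirectSum.of (fun g : Γ => ShiftedHom A B g) g f) =
      Φ.map f ≫ (d.inv g).hom.app B := by
  simp [mapOrbit]

open Classical in
theorem component_mapOrbit [Ψ.Additive] {A B : T} (g : Γ) (f : ⨁ g : Γ, ShiftedHom A B g) :
    d.component g (d.mapOrbit A B f) = f g := by
  induction f using DirectSum.induction_on with
  | zero => simp
  | add f f' h h' => rw [map_add, map_add, h, h']; rfl
  | of g' f =>
    rw [mapOrbit_of]
    by_cases h : g = g'
    · subst h
      rw [component_map_self, DirectSum.of_eq_same]
    · rw [component_map_ne d h, DirectSum.of_eq_of_ne _ _ _ h]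

variable [∀ g : Γ, (shiftFunctor T g).Additive]

open Classical in
/-- The functor from the orbit category induced by `Φ`. -/
noncomputable def orbitFunctor : OrbitCategory T Γ ⥤ S where
  obj X := Φ.obj X.obj
  map {A B} f := d.mapOrbit A.obj B.obj f
  map_id A := by
    refine (d.mapOrbit_of _).trans ?_
    rw [d.inv_zero, ← Functor.map_comp]
    refine Eq.trans (congrArg Φ.map ?_) (Φ.map_id A.obj)
    simp [ShiftedHom.mk₀, shiftFunctorZero']
  map_comp {A B C} f k := by
    change d.mapOrbit _ _ (OrbitCategory.compHom _ _ _ f k) = _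
    induction f using DirectSum.induction_on with
    | zero => simp
    | add f f' h h' =>
      simp only [map_add, AddMonoidHom.add_apply, h, h', Preadditive.add_comp]
    | of a f =>
      induction k using DirectSum.induction_on with
      | zero => simp
      | add k k' h h' => simp only [map_add, h, h', Preadditive.comp_add]
      | of b k =>
        rw [OrbitCategory.compHom_of _ _ rfl, mapOrbit_of, mapOrbit_of, mapOrbit_of, map_comp_inv]

instance : d.orbitFunctor.Additive where
  map_add {A B f g} := (d.mapOrbit A.obj B.obj).map_add f g

variable [Ψ.Additive]

instance : d.orbitFunctor.Faithful where
  map_injective {A B f f'} h := by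
    refine DFinsupp.ext fun g => ?_
    rw [← d.component_mapOrbit g f, ← d.component_mapOrbit g f']
    exact congrArg _ h

instance : d.orbitFunctor.Full where
  map_surjective {A B} k := by
    classical
    refine ⟨(∑ g : Γ, DirectSum.of (fun g : Γ => ShiftedHom A.obj B.obj g) g (d.component g k) :
      ⨁ g : Γ, ShiftedHom A.obj B.obj g), ?_⟩
    refine (map_sum (d.mapOrbit A.obj B.obj) _ _).trans ?_
    simp only [mapOrbit_of]
    exact d.sum_component k
end cover

/-- A retract in a pretriangulated category is a direct summand. -/
theorem exists_biprod_iso_of_retract {S : Type*} [Category* S] [HasZeroObject S] [Preadditive S]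
    [HasShift S ℤ] [∀ n : ℤ, (shiftFunctor S n).Additive] [Pretriangulated S] {Y Z : S}
    (i : Y ⟶ Z) (r : Z ⟶ Y) [IsIso (i ≫ r)] : ∃ Y' : S, Nonempty (Y ⊞ Y' ≅ Z) := by
  obtain ⟨Y', g, h, hT⟩ := Pretriangulated.distinguished_cocone_triangle i
  have : Mono i := mono_of_mono i r
  have h0 := (Pretriangulated.Triangle.mor₃_eq_zero_iff_mono₁ _ hT).2 this
  obtain ⟨e, -⟩ := Pretriangulated.exists_iso_binaryBiproduct_of_distTriang _ hT h0
  exact ⟨Y', ⟨e.symm⟩⟩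

/-- The family of the components is a two-sided inverse of `mapOrbit`, so that `orbitFunctor` is fully
faithful; its essential image contains `Φ (Ψ Y)`, of which `Y` is a retract. -/
theorem isCover {Γ T S : Type*} [AddCommGroup Γ] [Fintype Γ]
    [Category* T] [HasZeroObject T] [Preadditive T] [HasShift T ℤ]
    [∀ n : ℤ, (shiftFunctor T n).Additive] [Pretriangulated T] [IsTriangulated T]
    [HasShift T Γ] [∀ g : Γ, (shiftFunctor T g).CommShift ℤ]
    [∀ g : Γ, (shiftFunctor T g).IsTriangulated]
    [Category* S] [HasZeroObject S] [Preadditive S] [HasShift S ℤ]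
    [∀ n : ℤ, (shiftFunctor S n).Additive] [Pretriangulated S] [IsTriangulated S]
    {Φ : T ⥤ S} {Ψ : S ⥤ T} [Φ.Additive] [Ψ.Additive] (d : CoverData Γ Φ Ψ) :
    IsCover Γ T S := by
  refine ⟨d.orbitFunctor, inferInstance, inferInstance, inferInstance, fun Y => ?_⟩
  have := d.isIso_diag_sum Y
  obtain ⟨Y', ⟨e⟩⟩ := exists_biprod_iso_of_retract (d.diag.app Y) (d.sum.app Y)
  exact ⟨Y', ⟨Ψ.obj Y⟩, ⟨e⟩⟩

end CoverData
end CategoryTheory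

/-! ### Transfer of cover data along localizations -/

namespace CategoryTheory
namespace CoverData
universe w₁ w₂
variable {X Y : Type*} [Category* X] [Category* Y] [Preadditive X] [Preadditive Y]
  {A : Type w₁} [Category.{w₂} A] {B : Type w₁} [Category.{w₂} B]
  {Γ : Type*} [AddCommGroup Γ] [Fintype Γ] [HasShift X Γ]
  {φ : X ⥤ Y} {ψ : Y ⥤ X} {Φ : A ⥤ B} {Ψ : B ⥤ A}
  (Q : X ⥤ A) (R : Y ⥤ B)
  (α : Q ⋙ Φ ≅ φ ⋙ R) (β : R ⋙ Ψ ≅ ψ ⋙ Q)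
  (d : CoverData Γ φ ψ)

/-- The transformation `unit` of `Φ` and `Ψ` on the image of `Q`, given by that of `φ` and `ψ`. -/
def unitTransfer : Q ⋙ 𝟭 A ⟶ Q ⋙ Φ ⋙ Ψ where
  app K := Q.map (d.unit.app K) ≫ β.inv.app (φ.obj K) ≫ Ψ.map (α.inv.app K)
  naturality K K' f := by
    have h₁ := d.unit.naturality f
    have h₂ := β.inv.naturality (φ.map f)
    have h₃ := α.inv.naturality f
    dsimp at h₁ h₂ h₃ ⊢
    rw [← Functor.map_comp_assoc, h₁, Functor.map_comp_assoc, reassoc_of% h₂, ← Ψ.map_comp, h₃]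
    simp

/-- The transformation `proj` of `Φ` and `Ψ` on the image of `Q`, given by that of `φ` and `ψ`. -/
def projTransfer : Q ⋙ Φ ⋙ Ψ ⟶ Q ⋙ 𝟭 A where
  app K := Ψ.map (α.hom.app K) ≫ β.hom.app (φ.obj K) ≫ Q.map (d.proj.app K)
  naturality K K' f := by
    have h₁ := d.proj.naturality f
    have h₂ := β.hom.naturality (φ.map f)
    have h₃ := α.hom.naturality f
    dsimp at h₁ h₂ h₃ ⊢
    simp only [Category.assoc]
    rw [← Functor.map_comp_assoc, h₃, Functor.map_comp_assoc, reassoc_of% h₂, ← Q.map_comp, h₁]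
    simp

/-- The transformation `diag` of `Φ` and `Ψ` on the image of `R`, given by that of `φ` and `ψ`. -/
def diagTransfer : R ⋙ 𝟭 B ⟶ R ⋙ Ψ ⋙ Φ where
  app K := R.map (d.diag.app K) ≫ α.inv.app (ψ.obj K) ≫ Φ.map (β.inv.app K)
  naturality K K' f := by
    have h₁ := d.diag.naturality f
    have h₂ := α.inv.naturality (ψ.map f)
    have h₃ := β.inv.naturality f
    dsimp at h₁ h₂ h₃ ⊢
    rw [← Functor.map_comp_assoc, h₁, Functor.map_comp_assoc, reassoc_of% h₂, ← Φ.map_comp, h₃]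
    simp

/-- The transformation `sum` of `Φ` and `Ψ` on the image of `R`, given by that of `φ` and `ψ`. -/
def sumTransfer : R ⋙ Ψ ⋙ Φ ⟶ R ⋙ 𝟭 B where
  app K := Φ.map (β.hom.app K) ≫ α.hom.app (ψ.obj K) ≫ R.map (d.sum.app K)
  naturality K K' f := by
    have h₁ := d.sum.naturality f
    have h₂ := α.hom.naturality (ψ.map f)
    have h₃ := β.hom.naturality f
    dsimp at h₁ h₂ h₃ ⊢
    simp only [Category.assoc]
    rw [← Functor.map_comp_assoc, h₃, Functor.map_comp_assoc, reassoc_of% h₂, ← R.map_comp, h₁]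
    simp

section
variable [LiftsNatTrans.{w₁, w₂} Q]

theorem unitTransfer_app (K : X) : (extendNatTrans Q (d.unitTransfer Q R α β)).app (Q.obj K) =
    Q.map (d.unit.app K) ≫ β.inv.app (φ.obj K) ≫ Ψ.map (α.inv.app K) :=
  extendNatTrans_app_obj Q _ K

theorem projTransfer_app (K : X) : (extendNatTrans Q (d.projTransfer Q R α β)).app (Q.obj K) =
    Ψ.map (α.hom.app K) ≫ β.hom.app (φ.obj K) ≫ Q.map (d.proj.app K) :=
  extendNatTrans_app_obj Q _ K

end

section
variable [LiftsNatTrans.{w₁, w₂} R]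

theorem diagTransfer_app (K : Y) : (extendNatTrans R (d.diagTransfer Q R α β)).app (R.obj K) =
    R.map (d.diag.app K) ≫ α.inv.app (ψ.obj K) ≫ Φ.map (β.inv.app K) :=
  extendNatTrans_app_obj R _ K

theorem sumTransfer_app (K : Y) : (extendNatTrans R (d.sumTransfer Q R α β)).app (R.obj K) =
    Φ.map (β.hom.app K) ≫ α.hom.app (ψ.obj K) ≫ R.map (d.sum.app K) :=
  extendNatTrans_app_obj R _ K

end

variable [HasShift A Γ] [Q.CommShift Γ]

/-- The isomorphism `inv g` of `Φ` on the image of `Q`, given by that of `φ`. -/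
def invTransfer (g : Γ) : Q ⋙ shiftFunctor A g ⋙ Φ ≅ Q ⋙ Φ :=
  NatIso.ofComponents (fun K => Φ.mapIso ((Q.commShiftIso g).symm.app K) ≪≫ α.app (K⟦g⟧) ≪≫
    R.mapIso ((d.inv g).app K) ≪≫ α.symm.app K) fun {K K'} f => by
    have h₁ := (Q.commShiftIso g).inv.naturality f
    have h₂ := α.hom.naturality (f⟦g⟧')
    have h₃ := (d.inv g).hom.naturality f
    have h₄ := α.inv.naturality f
    dsimp at h₁ h₂ h₃ h₄ ⊢
    simp only [Category.assoc]
    rw [← Functor.map_comp_assoc, h₁, Functor.map_comp_assoc, reassoc_of% h₂,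
      ← R.map_comp_assoc, h₃, ← h₄]
    simp

variable [LiftsNatTrans.{w₁, w₂} Q]

theorem invTransfer_hom_app (g : Γ) (K : X) :
    (extendNatIso Q (d.invTransfer Q R α g)).hom.app (Q.obj K) =
      Φ.map ((Q.commShiftIso g).inv.app K) ≫ α.hom.app (K⟦g⟧) ≫ R.map ((d.inv g).hom.app K) ≫
        α.inv.app K :=
  extendNatIso_hom_app_obj Q _ K

theorem invTransfer_inv_app (g : Γ) (K : X) :
    (extendNatIso Q (d.invTransfer Q R α g)).inv.app (Q.obj K) =
      α.hom.app K ≫ R.map ((d.inv g).inv.app K) ≫ α.inv.app (K⟦g⟧) ≫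
        Φ.map ((Q.commShiftIso g).hom.app K) := by
  refine (extendNatIso_inv_app_obj Q _ K).trans ?_
  simp [invTransfer]

variable [LiftsNatTrans.{w₁, w₂} R]
variable [Preadditive A] [Preadditive B] [Q.Additive] [R.Additive] [Φ.Additive] [Ψ.Additive]

/-- Cover data pass to the targets of functors along which natural transformations extend. Each
identity is an equality of natural transformations, so that it can be tested on the image of `Q` or
`R`, where it reduces to the corresponding identity for `φ` and `ψ`. -/
noncomputable def transfer : CoverData Γ Φ Ψ where
  unit := extendNatTrans Q (d.unitTransfer Q R α β)
  proj := extendNatTrans Q (d.projTransfer Q R α β)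
  diag := extendNatTrans R (d.diagTransfer Q R α β)
  sum := extendNatTrans R (d.sumTransfer Q R α β)
  inv g := extendNatIso Q (d.invTransfer Q R α g)
  inv_zero T := by
    refine NatTrans.congr_app (natTrans_ext_of_essSurj Q (F := shiftFunctor A (0 : Γ) ⋙ Φ) (G := Φ)
      (τ := (extendNatIso Q (d.invTransfer Q R α 0)).hom)
      (σ := Functor.whiskerRight (shiftFunctorZero A Γ).hom Φ) fun K => ?_) T
    have h := α.hom.naturality ((shiftFunctorZero X Γ).hom.app K)
    dsimp at h
    rw [invTransfer_hom_app, d.inv_zero, Functor.commShiftIso_zero, Functor.CommShift.isoZero_inv_app,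
      ← reassoc_of% h]
    simp only [Functor.map_comp, Category.assoc, Iso.hom_inv_id_app]
    rw [← Φ.map_comp_assoc (Q.map _), ← Q.map_comp, Iso.inv_hom_id_app]
    simp
  inv_add a b T := by
    refine NatTrans.congr_app (natTrans_ext_of_essSurj Q
      (F := shiftFunctor A (a + b) ⋙ Φ) (G := Φ)
      (τ := (extendNatIso Q (d.invTransfer Q R α (a + b))).hom)
      (σ := Functor.whiskerRight (shiftFunctorAdd A a b).hom Φ ≫
        Functor.whiskerLeft (shiftFunctor A a) (extendNatIso Q (d.invTransfer Q R α b)).hom ≫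
        (extendNatIso Q (d.invTransfer Q R α a)).hom) fun K => ?_) T
    have h := (extendNatIso Q (d.invTransfer Q R α b)).hom.naturality ((Q.commShiftIso a).inv.app K)
    have h' := α.hom.naturality ((shiftFunctorAdd X a b).hom.app K)
    have h'' := α.hom.naturality ((shiftFunctorAdd X a b).inv.app K)
    have h₀ : R.map (φ.map ((shiftFunctorAdd X a b).inv.app K)) ≫
        R.map (φ.map ((shiftFunctorAdd X a b).hom.app K)) = 𝟙 _ := by
      rw [← R.map_comp, ← φ.map_comp, Iso.inv_hom_id_app, φ.map_id, R.map_id]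
    dsimp at h h' h'' ⊢
    -- Naturality of the extended `inv b` moves it from `(Q K)⟦a⟧` to `Q (K⟦a⟧)`, where it is known.
    rw [invTransfer_hom_app, invTransfer_hom_app, ← reassoc_of% h, invTransfer_hom_app,
      d.inv_add, Functor.commShiftIso_add, Functor.CommShift.isoAdd_inv_app]
    simp only [Functor.map_comp, Category.assoc, Iso.inv_hom_id_app_assoc, reassoc_of% h'']
    rw [reassoc_of% h₀]
  unit_sum T := by
    refine NatTrans.congr_app (natTrans_ext_of_essSurj Q (F := Φ) (G := Φ)
      (τ := Functor.whiskerRight (extendNatTrans Q (d.unitTransfer Q R α β)) Φ ≫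
        Functor.whiskerLeft Φ (extendNatTrans R (d.sumTransfer Q R α β)))
      (σ := 𝟙 Φ) fun K => ?_) T
    have h := (extendNatTrans R (d.sumTransfer Q R α β)).naturality (α.hom.app K)
    have h' := α.hom.naturality (d.unit.app K)
    have h₁ : Ψ.map (α.inv.app K) ≫ Ψ.map (α.hom.app K) = 𝟙 _ := by
      rw [← Functor.map_comp, Iso.inv_hom_id_app, Functor.map_id]
    dsimp at h h' ⊢
    -- Naturality of the extended `sum` moves it from `Φ (Q K)` to `R (φ K)`, where it is known.
    rw [← cancel_mono (α.hom.app K), Category.assoc, ← h, sumTransfer_app, unitTransfer_app]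
    simp only [← Φ.map_comp_assoc, Category.assoc, reassoc_of% h₁, Iso.inv_hom_id_app]
    dsimp
    rw [Category.comp_id, reassoc_of% h', ← R.map_comp, d.unit_sum]
    simp
  sum_proj T := by
    refine (NatTrans.app_sum Finset.univ T (fun g : Γ =>
        (Functor.whiskerRight (extendNatIso Q (d.invTransfer Q R α g)).inv (Ψ ⋙ Φ) ≫
        Functor.whiskerLeft (shiftFunctor A g)
          (Functor.whiskerRight (extendNatTrans Q (d.projTransfer Q R α β)) Φ) ≫
        (extendNatIso Q (d.invTransfer Q R α g)).hom : Φ ⋙ Ψ ⋙ Φ ⟶ Φ))).symm.trans <|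
      NatTrans.congr_app (natTrans_ext_of_essSurj Q (F := Φ ⋙ Ψ ⋙ Φ) (G := Φ)
      (τ := ∑ g : Γ,
        (Functor.whiskerRight (extendNatIso Q (d.invTransfer Q R α g)).inv (Ψ ⋙ Φ) ≫
        Functor.whiskerLeft (shiftFunctor A g)
          (Functor.whiskerRight (extendNatTrans Q (d.projTransfer Q R α β)) Φ) ≫
        (extendNatIso Q (d.invTransfer Q R α g)).hom : Φ ⋙ Ψ ⋙ Φ ⟶ Φ))
      (σ := Functor.whiskerLeft Φ (extendNatTrans R (d.sumTransfer Q R α β)))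
      fun K => ?_) T
    rw [NatTrans.app_sum]
    have h := (extendNatTrans R (d.sumTransfer Q R α β)).naturality (α.hom.app K)
    dsimp at h ⊢
    -- Both sides are moved to `R (φ K)` along `α` and compared summand by summand.
    rw [← cancel_mono (α.hom.app K), ← h, sumTransfer_app, ← d.sum_proj, Preadditive.sum_comp,
      R.map_sum, Preadditive.comp_sum, Preadditive.comp_sum, Preadditive.comp_sum]
    refine Finset.sum_congr rfl fun g _ => ?_
    have h₁ := (extendNatTrans Q (d.projTransfer Q R α β)).naturality ((Q.commShiftIso g).hom.app K)
    have h₂ := β.hom.naturality ((d.inv g).inv.app K)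
    have h₃ := α.hom.naturality (ψ.map ((d.inv g).inv.app K))
    have h₄ := α.hom.naturality (d.proj.app (K⟦g⟧))
    have h₅ : Φ.map (Ψ.map (α.inv.app (K⟦g⟧))) ≫ Φ.map (Ψ.map (α.hom.app (K⟦g⟧))) = 𝟙 _ := by
      rw [← Φ.map_comp, ← Ψ.map_comp, Iso.inv_hom_id_app, Ψ.map_id, Φ.map_id]
    have h₆ : Φ.map ((Q.commShiftIso g).hom.app K) ≫ Φ.map ((Q.commShiftIso g).inv.app K) =
        𝟙 _ := by
      rw [← Functor.map_comp, Iso.hom_inv_id_app, Functor.map_id]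
    dsimp at h₁ h₂ h₃ h₄ h₅
    rw [invTransfer_inv_app, invTransfer_hom_app]
    simp only [Functor.map_comp, Category.assoc, Iso.inv_hom_id_app]
    rw [← Φ.map_comp_assoc (Ψ.map (Φ.map _)), h₁, projTransfer_app]
    simp only [Functor.map_comp, Category.assoc]
    rw [reassoc_of% h₆, reassoc_of% h₅,
      ← Φ.map_comp_assoc (Ψ.map (R.map _)), h₂, Φ.map_comp_assoc, reassoc_of% h₄,
      reassoc_of% h₃]
    simp
  unit_proj T := by
    refine NatTrans.congr_app (natTrans_ext_of_essSurj Q (F := 𝟭 A) (G := 𝟭 A)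
      (τ := extendNatTrans Q (d.unitTransfer Q R α β) ≫
        extendNatTrans Q (d.projTransfer Q R α β)) (σ := 𝟙 _) fun K => ?_) T
    have h₁ : Ψ.map (α.inv.app K) ≫ Ψ.map (α.hom.app K) = 𝟙 _ := by
      rw [← Functor.map_comp, Iso.inv_hom_id_app, Functor.map_id]
    rw [NatTrans.comp_app, unitTransfer_app, projTransfer_app]
    simp only [Category.assoc, reassoc_of% h₁, Iso.inv_hom_id_app_assoc]
    rw [← Q.map_comp, d.unit_proj]
    simp
  unit_proj_ne g g' h T := by
    refine NatTrans.congr_app (natTrans_ext_of_essSurj Q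
      (F := shiftFunctor A g') (G := shiftFunctor A g)
      (τ := Functor.whiskerLeft (shiftFunctor A g') (extendNatTrans Q (d.unitTransfer Q R α β)) ≫
        Functor.whiskerRight (extendNatIso Q (d.invTransfer Q R α g')).hom Ψ ≫
        Functor.whiskerRight (extendNatIso Q (d.invTransfer Q R α g)).inv Ψ ≫
        Functor.whiskerLeft (shiftFunctor A g) (extendNatTrans Q (d.projTransfer Q R α β)))
      (σ := 0) fun K => ?_) T
    have h₁ := (extendNatTrans Q (d.projTransfer Q R α β)).naturality ((Q.commShiftIso g).hom.app K)
    have h₂ := (extendNatTrans Q (d.unitTransfer Q R α β)).naturality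
      ((Q.commShiftIso g').inv.app K)
    have h₃ : Ψ.map (α.inv.app (K⟦g⟧)) ≫ Ψ.map (α.hom.app (K⟦g⟧)) = 𝟙 _ := by
      rw [← Functor.map_comp, Iso.inv_hom_id_app, Functor.map_id]
    have h₄ : Ψ.map (α.inv.app (K⟦g'⟧)) ≫ Ψ.map (α.hom.app (K⟦g'⟧)) = 𝟙 _ := by
      rw [← Functor.map_comp, Iso.inv_hom_id_app, Functor.map_id]
    have h₅ : Ψ.map (α.inv.app K) ≫ Ψ.map (α.hom.app K) = 𝟙 _ := by
      rw [← Functor.map_comp, Iso.inv_hom_id_app, Functor.map_id]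
    have h₆ := β.hom.naturality ((d.inv g).inv.app K)
    have h₇ := β.inv.naturality ((d.inv g').hom.app K)
    have h₈ := d.unit_proj_ne g g' h K
    dsimp at h₁ h₂ h₆ h₇ ⊢
    rw [invTransfer_hom_app, invTransfer_inv_app]
    simp only [Functor.map_comp, Category.assoc]
    -- The extended `unit` and `proj` are moved from the shifts of `Q K` to the images of the shifts
    -- of `K`, and all comparison isomorphisms cancel.
    rw [h₁, ← reassoc_of% h₂, unitTransfer_app, projTransfer_app]
    simp only [Category.assoc, reassoc_of% h₃, reassoc_of% h₄, reassoc_of% h₅, reassoc_of% h₆,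
      ← reassoc_of% h₇, Iso.inv_hom_id_app_assoc]
    simp only [← Q.map_comp_assoc, h₈]
    simp
  isIso_diag_sum Y := by
    have h := (extendNatTrans R (d.diagTransfer Q R α β) ≫
      extendNatTrans R (d.sumTransfer Q R α β)).naturality (R.objObjPreimageIso Y).inv
    have h₁ : Φ.map (β.inv.app (R.objPreimage Y)) ≫ Φ.map (β.hom.app (R.objPreimage Y)) = 𝟙 _ := by
      rw [← Functor.map_comp, Iso.inv_hom_id_app, Functor.map_id]
    rw [NatTrans.comp_app, NatTrans.comp_app, diagTransfer_app, sumTransfer_app] at h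
    simp only [Category.assoc, reassoc_of% h₁, Iso.inv_hom_id_app_assoc, ← R.map_comp] at h
    have h₂ := d.isIso_diag_sum (R.objPreimage Y)
    have h₃ : IsIso (((extendNatTrans R (d.diagTransfer Q R α β)).app Y ≫
        (extendNatTrans R (d.sumTransfer Q R α β)).app Y) ≫
        (𝟭 B).map (R.objObjPreimageIso Y).inv) := by
      rw [Category.assoc, ← h]
      infer_instance
    exact IsIso.of_isIso_comp_right _ ((𝟭 B).map (R.objObjPreimageIso Y).inv)

end CoverData
end CategoryTheory

/-! ### Restriction of cover data to full subcategories -/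

namespace CategoryTheory
namespace CoverData
variable {X Y : Type*} [Category* X] [Category* Y] [Preadditive X] [Preadditive Y]
  {Γ : Type*} [AddCommGroup Γ] [Fintype Γ] [HasShift X Γ] {φ : X ⥤ Y} {ψ : Y ⥤ X}
  (d : CoverData Γ φ ψ) (P : ObjectProperty X) (P' : ObjectProperty Y) [P.IsStableUnderShift Γ]
  (hφ : ∀ K : P.FullSubcategory, P' (φ.obj K.obj)) (hψ : ∀ K : P'.FullSubcategory, P (ψ.obj K.obj))

/-- Cover data restrict to full subcategories stable under the functors and the action. -/
noncomputable def restrict :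
    CoverData Γ (P'.lift (P.ι ⋙ φ) hφ) (P.lift (P'.ι ⋙ ψ) hψ) where
  unit := { app K := ObjectProperty.homMk (d.unit.app K.obj)
            naturality _ _ f := P.ι.map_injective (d.unit.naturality f.hom) }
  proj := { app K := ObjectProperty.homMk (d.proj.app K.obj)
            naturality _ _ f := P.ι.map_injective (d.proj.naturality f.hom) }
  diag := { app K := ObjectProperty.homMk (d.diag.app K.obj)
            naturality _ _ f := P'.ι.map_injective (d.diag.naturality f.hom) }
  sum := { app K := ObjectProperty.homMk (d.sum.app K.obj)
           naturality _ _ f := P'.ι.map_injective (d.sum.naturality f.hom) }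
  inv g := NatIso.ofComponents
    (fun K => P'.isoMk (φ.mapIso ((P.ι.commShiftIso g).app K) ≪≫ (d.inv g).app K.obj))
    fun {K K'} f => P'.ι.map_injective (by
      have h₁ := (P.ι.commShiftIso g).hom.naturality f
      have h₂ := (d.inv g).hom.naturality f.hom
      dsimp at h₁ h₂
      change φ.map ((shiftFunctor P.FullSubcategory g).map f).hom ≫
        φ.map ((P.ι.commShiftIso g).hom.app K') ≫ (d.inv g).hom.app K'.obj =
        (φ.map ((P.ι.commShiftIso g).hom.app K) ≫ (d.inv g).hom.app K.obj) ≫ φ.map f.hom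
      rw [Category.assoc, ← h₂, ← φ.map_comp_assoc, ← φ.map_comp_assoc, h₁])
  inv_zero K := P'.ι.map_injective (by
    change φ.map ((P.ι.commShiftIso (0 : Γ)).hom.app K) ≫ (d.inv 0).hom.app K.obj =
      φ.map (P.ι.map ((shiftFunctorZero P.FullSubcategory Γ).hom.app K))
    rw [d.inv_zero, Functor.commShiftIso_zero, Functor.CommShift.isoZero_hom_app, ← φ.map_comp]
    simp)
  inv_add a b K := P'.ι.map_injective (by
    change φ.map ((P.ι.commShiftIso (a + b)).hom.app K) ≫ (d.inv (a + b)).hom.app K.obj =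
      φ.map (P.ι.map ((shiftFunctorAdd P.FullSubcategory a b).hom.app K)) ≫
      (φ.map ((P.ι.commShiftIso b).hom.app (K⟦a⟧)) ≫ (d.inv b).hom.app (K⟦a⟧).obj) ≫
      φ.map ((P.ι.commShiftIso a).hom.app K) ≫ (d.inv a).hom.app K.obj
    have h := (d.inv b).hom.naturality ((P.ι.commShiftIso a).hom.app K)
    dsimp at h
    rw [Category.assoc, ← reassoc_of% h, d.inv_add, Functor.commShiftIso_add,
      Functor.CommShift.isoAdd_hom_app]
    simp only [← φ.map_comp_assoc, Category.assoc]
    simp)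
  unit_sum K := P'.ι.map_injective (d.unit_sum K.obj)
  sum_proj K := P'.ι.map_injective (by
    refine Eq.trans ?_ (d.sum_proj K.obj)
    rw [Functor.map_sum]
    refine Finset.sum_congr rfl fun g _ => ?_
    have h := d.proj.naturality ((P.ι.commShiftIso g).hom.app K)
    have h' : (P.ι.commShiftIso g).inv.app K ≫ (P.ι.commShiftIso g).hom.app K = 𝟙 _ :=
      Iso.inv_hom_id_app _ _
    change φ.map (ψ.map ((d.inv g).inv.app K.obj ≫ φ.map ((P.ι.commShiftIso g).inv.app K))) ≫
      φ.map (d.proj.app (K⟦g⟧).obj) ≫ φ.map ((P.ι.commShiftIso g).hom.app K) ≫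
        (d.inv g).hom.app K.obj = _
    dsimp at h
    rw [← φ.map_comp_assoc (d.proj.app _)]
    erw [← h]
    simp only [← φ.map_comp_assoc, ← ψ.map_comp_assoc, Category.assoc, ← φ.map_comp, h']
    simp)
  unit_proj K := P.ι.map_injective (d.unit_proj K.obj)
  unit_proj_ne g g' hg K := P.ι.map_injective (by
    change d.unit.app (K⟦g'⟧).obj ≫
      ψ.map (φ.map ((P.ι.commShiftIso g').hom.app K) ≫ (d.inv g').hom.app K.obj) ≫
      ψ.map ((d.inv g).inv.app K.obj ≫ φ.map ((P.ι.commShiftIso g).inv.app K)) ≫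
      d.proj.app (K⟦g⟧).obj = 0
    have h := d.unit.naturality ((P.ι.commShiftIso g').hom.app K)
    have h' := d.proj.naturality ((P.ι.commShiftIso g).inv.app K)
    have h'' := d.unit_proj_ne g g' hg K.obj
    dsimp at h h'
    simp only [ψ.map_comp, Category.assoc]
    erw [h', ← reassoc_of% h, reassoc_of% h'']
    simp)
  isIso_diag_sum K := by
    have := d.isIso_diag_sum K.obj
    rw [← isIso_iff_of_reflects_iso _ P'.ι]
    exact this

end CoverData
end CategoryTheory

/-! ### Cover data for complexes of graded modules -/

namespace FGGrMod

/-- The inverse of multiplication by the order of `L` is multiplication by an element of the center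
of `S`; it has degree zero, as multiplication by an integer commutes with the projections to the
components. -/
theorem isIso_card_smul_id {S : Type u} [Ring S] {M : Type v} [AddCommGroup M]
    {𝒜 : M → AddSubgroup S} {L : AddSubgroup M} (hL : IsUnit ((Nat.card L : ℕ) : S))
    (E : FGGrMod (coarsen 𝒜 L)) : IsIso (Nat.card L • 𝟙 E) := by
  obtain ⟨c, hc⟩ := hL
  have hcomm (s : S) : Commute s (↑c⁻¹ : S) := by
    have : Commute s (c : S) := by rw [hc]; exact (Nat.cast_commute _ _).symm
    exact this.units_inv_right
  have hinv (x : E.carrier) : Nat.card L • ((↑c⁻¹ : S) • x) = x := by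
    rw [← Nat.cast_smul_eq_nsmul S, ← hc, smul_smul, Units.mul_inv, one_smul]
  have hinv' (x : E.carrier) : (↑c⁻¹ : S) • (Nat.card L • x) = x := by
    rw [← Nat.cast_smul_eq_nsmul S, ← hc, smul_smul, Units.inv_mul, one_smul]
  let r : E ⟶ E :=
    { toLin :=
        { toFun x := (↑c⁻¹ : S) • x
          map_add' := smul_add _
          map_smul' s x := by
            rw [RingHom.id_apply, smul_smul, smul_smul, (hcomm s).eq] }
      map_mem {q x} hx := by
        change (↑c⁻¹ : S) • x ∈ E.grading q
        rw [mem_iff_proj]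
        have h : Nat.card L • E.proj q ((↑c⁻¹ : S) • x) = x := by
          rw [← map_nsmul, hinv, E.proj_same hx]
        rw [← hinv' (E.proj q _), h] }
  exact ⟨r, by ext x; exact hinv' x, by ext x; exact hinv x⟩

variable {S : Type u} [Ring S] [IsNoetherianRing S] {M : Type v} [AddCommGroup M] [DecidableEq M]
  (𝒜 : M → AddSubgroup S) [GradedRing 𝒜] (L : AddSubgroup M) [Fintype L]

/-- Cover data for the termwise coarsening and spreading of complexes, given by the units and
counits of the two adjunctions. -/
noncomputable def complexCoverData (hL : IsUnit ((Nat.card L : ℕ) : S)) :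
    CoverData L ((coarsening L 𝒜).mapHomologicalComplex (ComplexShape.up ℤ))
      ((spread 𝒜 L).mapHomologicalComplex (ComplexShape.up ℤ)) where
  unit :=
    { app K :=
        { f n := (coarseningAdjSpread 𝒜 L).unit.app (K.X n)
          comm' i j _ := ((coarseningAdjSpread 𝒜 L).unit.naturality (K.d i j)).symm }
      naturality _ _ f := by
        ext n : 1
        exact (coarseningAdjSpread 𝒜 L).unit.naturality (f.f n) }
  proj :=
    { app K :=
        { f n := (spreadAdjCoarsening 𝒜 L).counit.app (K.X n)
          comm' i j _ := ((spreadAdjCoarsening 𝒜 L).counit.naturality (K.d i j)).symm }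
      naturality _ _ f := by
        ext n : 1
        exact (spreadAdjCoarsening 𝒜 L).counit.naturality (f.f n) }
  diag :=
    { app K :=
        { f n := (spreadAdjCoarsening 𝒜 L).unit.app (K.X n)
          comm' i j _ := ((spreadAdjCoarsening 𝒜 L).unit.naturality (K.d i j)).symm }
      naturality _ _ f := by
        ext n : 1
        exact (spreadAdjCoarsening 𝒜 L).unit.naturality (f.f n) }
  sum :=
    { app K :=
        { f n := (coarseningAdjSpread 𝒜 L).counit.app (K.X n)
          comm' i j _ := ((coarseningAdjSpread 𝒜 L).counit.naturality (K.d i j)).symm }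
      naturality _ _ f := by
        ext n : 1
        exact (coarseningAdjSpread 𝒜 L).counit.naturality (f.f n) }
  inv l := NatIso.mapHomologicalComplex (F := twist (l : M) ⋙ coarsening L 𝒜)
    (coarseningTwist L l) (ComplexShape.up ℤ)
  inv_zero K := by
    ext n x
    rfl
  inv_add a b K := by
    ext n x
    rfl
  unit_sum K := by
    ext n : 1
    exact (coarseningAdjSpread 𝒜 L).left_triangle_components (K.X n)
  sum_proj K := by
    ext n : 1
    refine Eq.trans ?_ (sum_coarsening_ofSpread 𝒜 L (K.X n))
    exact map_sum (HomologicalComplex.Hom.fAddMonoidHom n) _ _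
  unit_proj K := by
    ext n : 1
    exact toSpread_comp_ofSpread 𝒜 L (K.X n)
  unit_proj_ne l l' h K := by
    ext n : 1
    exact toSpread_comp_ofSpread_twist 𝒜 L (K.X n) h
  isIso_diag_sum K := by
    refine @HomologicalComplex.Hom.isIso_of_components _ _ _ _ _ _ _ _ fun n => ?_
    have := isIso_card_smul_id hL (K.X n)
    rwa [← diagSpread_comp_spreadSum] at this

end FGGrMod

/-! ### Cover data for singularity categories -/

namespace FGGrMod
open DerivedCategory
variable {S : Type u} [Ring S] [IsNoetherianRing S] {M : Type v} [AddCommGroup M]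
  (𝒜 : M → AddSubgroup S) (L : AddSubgroup M)

/-- The localization functor commutes with the action of `L`, by the isomorphisms from which the
action on the derived category is defined. -/
noncomputable instance commShiftQ :
    (Q (C := FGGrMod 𝒜)).CommShift L :=
  have := Localization.full_whiskeringLeft DerivedCategory.Q
    (HomologicalComplex.quasiIso (FGGrMod 𝒜) (ComplexShape.up ℤ)) (DerivedCategory (FGGrMod 𝒜))
  have := Localization.faithful_whiskeringLeft DerivedCategory.Q
    (HomologicalComplex.quasiIso (FGGrMod 𝒜) (ComplexShape.up ℤ)) (DerivedCategory (FGGrMod 𝒜))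
  let i (l : L) : Q ⋙ (twist (l : M) : FGGrMod 𝒜 ⥤ FGGrMod 𝒜).mapDerivedCategory ≅
      shiftFunctor (CochainComplex (FGGrMod 𝒜) ℤ) l ⋙ Q :=
    (twist (l : M)).mapDerivedCategoryFactors
  Functor.CommShift.ofInduced DerivedCategory.Q L (fun l => (twist (l : M)).mapDerivedCategory) i

instance : (cohBounded (FGGrMod 𝒜)).IsStableUnderShift L :=
  inferInstanceAs (((TStructure.t (C := FGGrMod 𝒜)).bounded.inverseImage Q).IsStableUnderShift L)

noncomputable instance commShiftBoundedQ : (boundedQ (FGGrMod 𝒜)).CommShift L :=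
  letI : ((cohBounded (FGGrMod 𝒜)).ι ⋙ Q).CommShift L := inferInstance
  Functor.CommShift.ofComp ((TStructure.t (C := FGGrMod 𝒜)).bounded.liftCompιIso
    ((cohBounded (FGGrMod 𝒜)).ι ⋙ Q) fun K => K.2) L

noncomputable instance commShiftSingularityQ : (singularityQ (FGGrMod 𝒜)).CommShift L :=
  letI : ((grPerf 𝒜).trW.Q).CommShift L := inferInstance
  inferInstanceAs ((boundedQ (FGGrMod 𝒜) ⋙ (grPerf 𝒜).trW.Q).CommShift L)

end FGGrMod

namespace DerivedCategory
universe w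
variable (C : Type u) [Category.{v} C] [Abelian C] [HasDerivedCategory.{w} C]

instance : (boundedQ C).Additive where
  map_add {_ _ f g} := (Bounded.ι (C := C)).map_injective (Q.map_add (f := f.hom) (g := g.hom))

instance : (singularityQ C).Additive :=
  inferInstanceAs ((boundedQ C ⋙ _).Additive)
end DerivedCategory

theorem mainTheorem9 {M : Type v} [AddCommGroup M] [AddGroup.FG M] [DecidableEq M]
    {S : Type u} [Ring S] [IsNoetherianRing S] (𝒜 : M → AddSubgroup S) [GradedRing 𝒜]
    (L : AddSubgroup M) [Finite L] (n : ℕ) (hL : Nat.card L = n) (hn : IsUnit (n : S)) :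
    IsCover L (GrDsg 𝒜) (GrDsg (coarsen 𝒜 L)) := by
  subst hL
  have := Fintype.ofFinite L
  let d : CoverData L (DerivedCategory.mapCohBounded (FGGrMod.coarsening L 𝒜))
      (DerivedCategory.mapCohBounded (FGGrMod.spread 𝒜 L)) :=
    (FGGrMod.complexCoverData 𝒜 L hn).restrict _ _ _ _
  exact (d.transfer (DerivedCategory.singularityQ _) (DerivedCategory.singularityQ _)
    (DerivedCategory.mapSingularityFactors (FGGrMod.coarsening L 𝒜))
    (DerivedCategory.mapSingularityFactors (FGGrMod.spread 𝒜 L))).isCover
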